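/- **Setting.** Let $n\in\mathbb N$, $\mathbb D^n=\{z\in\mathbb C^n:|z_k|<1\ \forall k\}$ and $\mathbb T^n=\{z\in\mathbb C^n:|z_k|=1\ \forall k\}$, with normalized Lebesgue measure $m_n$. The Hardy space $\mathbb H^2(\mathbb D^n)$ is the Hilbert space of holomorphic $f:\mathbb D^n\to\mathbb C$ for which $\|f\|^2=\lim_{r\to1^-}\int_{\mathbb T^n}|f(rw)|^2\,dm_n(w)$ is finite, with inner product $\langle f,g\rangle=\lim_{r\to1^-}\int_{\mathbb T^n}f(rw)\overline{g(rw)}\,dm_n(w)$ and reproducing functions $k_{z_0}(z)=\prod_{i=1}^n(1-\overline{z_{0,i}}\,z_i)^{-1}$, $z_0\in\mathbb D^n$. **Assumption 1.** $F:\mathbb D^n\cup\mathbb T^n\to\mathbb C^n$ is continuous, is holomorphic on $\mathbb D^n$, and generates a flow $(t,z)\mapsto\varphi^t(z)$, $\mathbb R^+\times\mathbb D^n\to\mathbb D^n$ (that is, $\varphi^0=\mathrm{id}$, $\varphi^{t+s}=\varphi^t\circ\varphi^s$ and $\frac{d}{dt}\varphi^t(z)=F(\varphi^t(z))$ on $\mathbb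 D^n$). For every $t\ge0$, $\varphi^t$ is holomorphic on $\mathbb D^n$ and extends continuously to $\mathbb D^n\cup\mathbb T^n$; the extension is again denoted by $\varphi^t$. **Assumption 2.** For every $t>0$ there is $R_t\in(0,1)$ such that $|\varphi^t_j(z)|<R_t$ for all $z\in\mathbb T^n$ and all $j=1,\dots,n$. Let $A_Ff=F\cdot\nabla f=\sum_{k=1}^n F_k\,\partial f/\partial z_k$ on $D(A_F)=\{f\in\mathbb H^2(\mathbb D^n):F\cdot\nabla f\in\mathbb H^2(\mathbb D^n)\}$, let $A_F^*$ be its Hilbert space adjoint, let $K(t)f=f\circ\varphi^t$ ($t\ge0$) be the Koopman operators, and let $x_0\in\mathbb D^n$. A pseudo-weak solution on a Hilbert space $X$ of $\dot f(t)=Af(t)+\Gamma(t)$, $f(0)=f_0$, with $A$ closed and densely defined, is a function $f:[0,\infty)\to X$ with $f(0)=f_0$ such that $f$ is continuous on $[0,\tau]$ for every $\tau>0$ and such that, for every $g\in D(A^*)$, $t\mapsto\langle f(t),g\rangle$ is absolutely continuous on $[0,\tau]$ for every $\tau>0$ and $\frac{d}{dt}\langle f(t),g\rangle=\langle f(t),A^*g\rangle+\langle\Gamma(t),g\rangle$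 for every $t\ge0$ (one-sided derivative at $t=0$). **Proposition.** Under Assumptions 1 and 2, $A_F$ and $A_F^*$ are densely defined and closed, every $K(t)$, $t\ge0$, is a bounded operator on $\mathbb H^2(\mathbb D^n)$, and the dual Koopman system $$\dot f(t)=A_F^*f(t),\qquad f(0)=k_{x_0},$$ has exactly one pseudo-weak solution on $\mathbb H^2(\mathbb D^n)$, namely $$f(t)=K(t)^*k_{x_0}=k_{\varphi^t(x_0)},\qquad t\ge0.$$ -/

import Mathlib

noncomputable section

open MeasureTheory Filter Topology Set
open scoped ComplexConjugate

namespace PolydiscKoopman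

/-- The open unit polydisc `𝔻ⁿ`. -/
def polydisc (n : ℕ) : Set (Fin n → ℂ) := {z | ∀ k, ‖z k‖ < 1}

/-- The torus `𝕋ⁿ`, the distinguished boundary of `𝔻ⁿ`. -/
def torus (n : ℕ) : Set (Fin n → ℂ) := {z | ∀ k, ‖z k‖ = 1}

/-- The normalized Lebesgue measure on `𝕋ⁿ`, on the angles `θ = 2π x` with `x ∈ (ℝ/ℤ)ⁿ`. -/
abbrev torusMeasure (n : ℕ) : Measure (UnitAddTorus (Fin n)) :=
  Measure.pi fun _ => AddCircle.haarAddCircle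

/-- The point `(exp(2πi x₁), …, exp(2πi xₙ))` of `𝕋ⁿ`. -/
def torusPt {n : ℕ} (w : UnitAddTorus (Fin n)) : Fin n → ℂ := fun k => fourier 1 (w k)

theorem polydisc_eq_ball (n : ℕ) : polydisc n = Metric.ball 0 1 := by
  ext z
  simp [polydisc, pi_norm_lt_iff]

theorem isOpen_polydisc (n : ℕ) : IsOpen (polydisc n) := by
  rw [polydisc_eq_ball]; exact Metric.isOpen_ball

theorem norm_fourier_apply (k : ℤ) (u : UnitAddCircle) : ‖(fourier k u : ℂ)‖ = 1 := by
  rw [fourier_apply]; exact Circle.norm_coe _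

theorem norm_torusPt {n : ℕ} (w : UnitAddTorus (Fin n)) (k : Fin n) : ‖torusPt w k‖ = 1 :=
  norm_fourier_apply _ _

theorem continuous_torusPt {n : ℕ} : Continuous (torusPt (n := n)) := by
  unfold torusPt; fun_prop

theorem mul_torusPt_mem {n : ℕ} {l : Fin n → ℂ} (hl : l ∈ polydisc n)
    (w : UnitAddTorus (Fin n)) : l * torusPt w ∈ polydisc n := by
  intro k; simpa [norm_torusPt] using hl k

theorem continuous_slice {n : ℕ} {f : (Fin n → ℂ) → ℂ} (hf : DifferentiableOn ℂ f (polydisc n))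
    {l : Fin n → ℂ} (hl : l ∈ polydisc n) : Continuous fun w => f (l * torusPt w) :=
  hf.continuousOn.comp_continuous (continuous_const.mul continuous_torusPt)
    (mul_torusPt_mem hl)

theorem integral_fourier_haar (k : ℤ) :
    ∫ u : UnitAddCircle, fourier k u ∂AddCircle.haarAddCircle = if k = 0 then 1 else 0 := by
  have h := fourierCoeff_fourier (T := 1) k
  have h0 := congrFun h 0
  simp only [fourierCoeff, Pi.single_apply, neg_zero, fourier_zero, one_smul] at h0
  rw [h0]
  simp [eq_comm]

theorem circle_coeff {h : ℂ → ℂ} (hh : DifferentiableOn ℂ h (Metric.ball 0 1)) :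
    ∃ c : ℕ → ℂ, ∀ s : ℂ, ‖s‖ < 1 → ∀ k : ℤ,
      ∫ u : UnitAddCircle, fourier (-k) u * h (s * fourier 1 u) ∂AddCircle.haarAddCircle
        = if 0 ≤ k then c k.toNat * s ^ k.toNat else 0 := by
  have H := fun z hz => Complex.hasSum_taylorSeries_on_ball hh (z := z) hz
  refine ⟨fun i => ((i.factorial : ℂ)⁻¹ * iteratedDeriv i h 0), fun s hs k => ?_⟩
  set c : ℕ → ℂ := fun i => ((i.factorial : ℂ)⁻¹ * iteratedDeriv i h 0) with hc
  have Hc : ∀ z : ℂ, ‖z‖ < 1 → HasSum (fun i => c i * z ^ i) (h z) := by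
    intro z hz
    refine (H z (by simpa using hz)).congr_fun fun i => ?_
    simp only [hc, sub_zero, smul_eq_mul]; ring
  have hmem : ∀ u : UnitAddCircle, ‖s * fourier 1 u‖ < 1 := fun u => by
    rw [norm_mul, norm_fourier_apply, mul_one]; exact hs
  have hpow : ∀ (i : ℕ) (u : UnitAddCircle), (fourier 1 u : ℂ) ^ i = fourier (i : ℤ) u := by
    intro i u
    induction i with
    | zero => simp
    | succ i ih => rw [pow_succ, ih, Nat.cast_succ, fourier_add]
  have hF : ∀ (i : ℕ) (u : UnitAddCircle),
      fourier (-k) u * (c i * (s * fourier 1 u) ^ i) = c i * s ^ i * fourier (i - k : ℤ) u := by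
    intro i u
    rw [mul_pow, hpow, sub_eq_add_neg, fourier_add]; ring
  have hS := hasSum_integral_of_summable_integral_norm (μ := AddCircle.haarAddCircle (T := 1))
    (F := fun (i : ℕ) (u : UnitAddCircle) => fourier (-k) u * (c i * (s * fourier 1 u) ^ i)) ?_ ?_
  · have h1 : ∀ u : UnitAddCircle, ∑' i : ℕ, fourier (-k) u * (c i * (s * fourier 1 u) ^ i)
        = fourier (-k) u * h (s * fourier 1 u) := fun u =>
      ((Hc _ (hmem u)).mul_left _).tsum_eq
    simp_rw [h1, hF, integral_const_mul, integral_fourier_haar] at hS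
    rw [← hS.tsum_eq]
    split_ifs with hk
    · rw [tsum_eq_single k.toNat]
      · simp [hk]
      · intro i hi
        rw [if_neg (by omega)]; simp
    · refine (tsum_congr fun i => ?_).trans tsum_zero
      rw [if_neg (by omega), mul_zero]
  · intro i
    refine Continuous.integrable_of_hasCompactSupport (by fun_prop) (.of_compactSpace _)
  · simp_rw [hF]
    simpa only [norm_mul, norm_fourier_apply, mul_one, integral_const, probReal_univ, one_smul]
      using (Hc s hs).summable.norm

/-- The `m`-th Fourier coefficient of `w ↦ f(l₁ w₁, …, lₙ wₙ)`. -/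
def coef {n : ℕ} (f : (Fin n → ℂ) → ℂ) (m : Fin n → ℤ) (l : Fin n → ℂ) : ℂ :=
  ∫ w, UnitAddTorus.mFourier (-m) w * f (l * torusPt w) ∂torusMeasure n

theorem torusPt_add_single {n : ℕ} (l : Fin n → ℂ) (j : Fin n) (s : ℂ)
    (w : UnitAddTorus (Fin n)) (u : UnitAddCircle) :
    Function.update l j s * torusPt (w + Pi.single j u)
      = Function.update (l * torusPt w) j (s * fourier 1 u * fourier 1 (w j)) := by
  ext k
  by_cases hk : k = j
  · subst hk
    simp only [torusPt, Pi.mul_apply, Function.update_self, Pi.add_apply, Pi.single_eq_same,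
      fourier_one, AddCircle.toCircle_add, Circle.coe_mul]
    ring
  · simp [torusPt, hk]

theorem mFourier_add_single {n : ℕ} (m : Fin n → ℤ) (j : Fin n)
    (w : UnitAddTorus (Fin n)) (u : UnitAddCircle) :
    UnitAddTorus.mFourier m (w + Pi.single j u)
      = UnitAddTorus.mFourier m w * fourier (m j) u := by
  simp only [UnitAddTorus.mFourier, ContinuousMap.coe_mk, Pi.add_apply]
  rw [← Finset.mul_prod_erase _ _ (Finset.mem_univ j),
    ← Finset.mul_prod_erase _ (fun i => fourier (m i) (w i)) (Finset.mem_univ j)]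
  have : ∀ i ∈ Finset.univ.erase j, fourier (m i) (w i + Pi.single (M := fun _ => UnitAddCircle) j u i) = fourier (m i) (w i) := by
    intro i hi
    rw [Pi.single_eq_of_ne (Finset.ne_of_mem_erase hi), add_zero]
  rw [Finset.prod_congr rfl this, Pi.single_eq_same]
  simp only [fourier_apply, smul_add, AddCircle.toCircle_add, Circle.coe_mul]
  ring

theorem coef_update {n : ℕ} {f : (Fin n → ℂ) → ℂ} (hf : DifferentiableOn ℂ f (polydisc n))
    (m : Fin n → ℤ) {l : Fin n → ℂ} (hl : l ∈ polydisc n) (j : Fin n) :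
    ∃ C : ℂ, ∀ s : ℂ, ‖s‖ < 1 →
      coef f m (Function.update l j s) = if 0 ≤ m j then C * s ^ (m j).toNat else 0 := by
  have hupd : ∀ (l' : Fin n → ℂ), l' ∈ polydisc n → ∀ s : ℂ, ‖s‖ < 1 →
      Function.update l' j s ∈ polydisc n := by
    intro l' hl' s hs k
    by_cases hk : k = j
    · subst hk; simpa using hs
    · simpa [hk] using hl' k
  have hw : ∀ w : UnitAddTorus (Fin n), DifferentiableOn ℂ
      (fun t : ℂ => f (Function.update (l * torusPt w) j (t * fourier 1 (w j))))
      (Metric.ball 0 1) := by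
    intro w
    refine hf.comp (t := polydisc n) ?_ ?_
    · intro t _
      refine DifferentiableAt.differentiableWithinAt ?_
      rw [differentiableAt_pi]
      intro k
      by_cases hk : k = j
      · subst hk; simp; 
      · simp [hk]
    · intro t ht
      refine hupd _ (mul_torusPt_mem hl w) _ ?_
      rw [norm_mul, norm_fourier_apply, mul_one]; simpa using ht
  choose c hc using fun w => circle_coeff (hw w)
  refine ⟨∫ w, UnitAddTorus.mFourier (-m) w * c w (m j).toNat ∂torusMeasure n, fun s hs => ?_⟩
  have hl' := hupd l hl s hs
  have hcont := continuous_slice hf hl'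
  have e1 : coef f m (Function.update l j s) =
      ∫ u : UnitAddCircle, ∫ w, UnitAddTorus.mFourier (-m) (w + Pi.single j u) *
        f (Function.update l j s * torusPt (w + Pi.single j u)) ∂torusMeasure n
          ∂AddCircle.haarAddCircle := by
    have : ∀ u : UnitAddCircle, ∫ w, UnitAddTorus.mFourier (-m) (w + Pi.single j u) *
        f (Function.update l j s * torusPt (w + Pi.single j u)) ∂torusMeasure n
        = coef f m (Function.update l j s) := fun u =>
      integral_add_right_eq_self (μ := torusMeasure n)
        (fun w => UnitAddTorus.mFourier (-m) w * f (Function.update l j s * torusPt w)) _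
    simp_rw [this]
    simp
  rw [e1, integral_integral_swap]
  · have e2 : ∀ w : UnitAddTorus (Fin n),
        ∫ u : UnitAddCircle, UnitAddTorus.mFourier (-m) (w + Pi.single j u) *
          f (Function.update l j s * torusPt (w + Pi.single j u)) ∂AddCircle.haarAddCircle
        = UnitAddTorus.mFourier (-m) w *
            (if 0 ≤ m j then c w (m j).toNat * s ^ (m j).toNat else 0) := by
      intro w
      rw [← hc w s hs (m j), ← integral_const_mul]
      refine integral_congr_ae (.of_forall fun u => ?_)
      simp only
      rw [mFourier_add_single, torusPt_add_single, Pi.neg_apply]; ring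
    simp_rw [e2]
    split_ifs with hm
    · rw [← integral_mul_const]
      refine integral_congr_ae (.of_forall fun w => ?_)
      simp only; ring
    · simp
  · refine Continuous.integrable_of_hasCompactSupport ?_ (.of_compactSpace _)
    have hadd : Continuous fun p : UnitAddCircle × UnitAddTorus (Fin n) => p.2 + Pi.single j p.1 :=
      continuous_snd.add ((continuous_single j).comp continuous_fst)
    exact ((UnitAddTorus.mFourier (-m)).continuous.comp hadd).mul (hcont.comp hadd)

theorem parseval_continuous {n : ℕ} (F G : C(UnitAddTorus (Fin n), ℂ)) :
    HasSum (fun m : Fin n → ℤ =>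
      conj (∫ w, UnitAddTorus.mFourier (-m) w * F w ∂torusMeasure n) *
        ∫ w, UnitAddTorus.mFourier (-m) w * G w ∂torusMeasure n)
      (∫ w, conj (F w) * G w ∂torusMeasure n) := by
  have h := UnitAddTorus.hasSum_prod_mFourierCoeff
    (ContinuousMap.toLp (E := ℂ) 2 (torusMeasure n) ℂ F)
    (ContinuousMap.toLp (E := ℂ) 2 (torusMeasure n) ℂ G)
  have e : ∫ w, conj ((ContinuousMap.toLp (E := ℂ) 2 (torusMeasure n) ℂ F) w) *
      (ContinuousMap.toLp (E := ℂ) 2 (torusMeasure n) ℂ G) w ∂torusMeasure n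
      = ∫ w, conj (F w) * G w ∂torusMeasure n := by
    refine integral_congr_ae ?_
    filter_upwards [ContinuousMap.coeFn_toLp (p := 2) (𝕜 := ℂ) (torusMeasure n) F,
      ContinuousMap.coeFn_toLp (p := 2) (𝕜 := ℂ) (torusMeasure n) G] with w h1 h2
    rw [h1, h2]
  have e' : ∀ (H : C(UnitAddTorus (Fin n), ℂ)) (m : Fin n → ℤ),
      UnitAddTorus.mFourierCoeff (ContinuousMap.toLp (E := ℂ) 2 (torusMeasure n) ℂ H) m
        = ∫ w, UnitAddTorus.mFourier (-m) w * H w ∂torusMeasure n := fun H m =>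
    UnitAddTorus.mFourierCoeff_toLp H m
  rw [← e]
  refine h.congr_fun fun m => ?_
  rw [← e', ← e']

/-- A multi-index of natural numbers, as one of integers. -/
def castInt {n : ℕ} (k : Fin n → ℕ) : Fin n → ℤ := fun j => (k j : ℤ)

theorem castInt_apply {n : ℕ} (k : Fin n → ℕ) (j : Fin n) : castInt k j = (k j : ℤ) := rfl

/-- `z^k = z₁^k₁ ⋯ zₙ^kₙ`. -/
def monomial {n : ℕ} (k : Fin n → ℕ) (z : Fin n → ℂ) : ℂ := ∏ j, z j ^ k j

/-- The `k`-th Taylor coefficient at `0`, from the Cauchy integral on the torus of radius `1/2`. -/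
def taylor {n : ℕ} (f : (Fin n → ℂ) → ℂ) (k : Fin n → ℕ) : ℂ :=
  coef f (castInt k) (fun _ => 1 / 2) * 2 ^ (∑ j, k j)

theorem half_mem (n : ℕ) : (fun _ => 1 / 2 : Fin n → ℂ) ∈ polydisc n := by
  intro k; norm_num

theorem coef_piecewise {n : ℕ} {f : (Fin n → ℂ) → ℂ}
    (hf : DifferentiableOn ℂ f (polydisc n)) (k : Fin n → ℕ) {l p : Fin n → ℂ}
    (hl : l ∈ polydisc n) (hp : p ∈ polydisc n) (S : Finset (Fin n)) :
    coef f (castInt k) (S.piecewise p l) * ∏ j ∈ S, l j ^ k j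
      = coef f (castInt k) l * ∏ j ∈ S, p j ^ k j := by
  induction S using Finset.induction_on with
  | empty => simp
  | insert j S hj ih =>
    have hq : S.piecewise p l ∈ polydisc n := by
      intro i
      by_cases hi : i ∈ S
      · simpa [hi] using hp i
      · simpa [hi] using hl i
    obtain ⟨C, hC⟩ := coef_update hf (castInt k) hq j
    have h1 := hC (p j) (hp j)
    have h2 := hC (l j) (hl j)
    have e : Function.update (S.piecewise p l) j (l j) = S.piecewise p l := by
      rw [← Finset.piecewise_eq_of_notMem S p l hj, Function.update_eq_self]
    rw [e] at h2
    rw [← Finset.piecewise_insert] at h1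
    simp only [castInt_apply, Nat.cast_nonneg, if_true, Int.toNat_natCast] at h1 h2
    rw [Finset.prod_insert hj, Finset.prod_insert hj]
    rw [h1]
    rw [h2] at ih
    linear_combination (p j ^ k j) * ih

theorem coef_eq {n : ℕ} {f : (Fin n → ℂ) → ℂ} (hf : DifferentiableOn ℂ f (polydisc n))
    (k : Fin n → ℕ) {l : Fin n → ℂ} (hl : l ∈ polydisc n) :
    coef f (castInt k) l = taylor f k * monomial k l := by
  have h := coef_piecewise hf k (half_mem n) hl Finset.univ
  rw [Finset.piecewise_univ, Finset.prod_pow_eq_pow_sum] at h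
  rw [taylor, monomial, mul_right_comm, ← h, mul_assoc, ← mul_pow]
  norm_num

theorem coef_neg {n : ℕ} {f : (Fin n → ℂ) → ℂ} (hf : DifferentiableOn ℂ f (polydisc n))
    {m : Fin n → ℤ} {j : Fin n} (hm : m j < 0) {l : Fin n → ℂ} (hl : l ∈ polydisc n) :
    coef f m l = 0 := by
  obtain ⟨C, hC⟩ := coef_update hf m hl j
  have := hC (l j) (hl j)
  rwa [Function.update_eq_self, if_neg (by omega)] at this

theorem castInt_injective (n : ℕ) : Function.Injective (castInt (n := n)) := by
  intro a b h
  funext j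
  exact Int.ofNat_inj.mp (congrFun h j)

theorem exists_neg_of_notMem_range {n : ℕ} {m : Fin n → ℤ} (hm : m ∉ range (castInt (n := n))) :
    ∃ j, m j < 0 := by
  by_contra! h
  exact hm ⟨fun j => (m j).toNat, funext fun j => Int.toNat_of_nonneg (h j)⟩

theorem parseval {n : ℕ} {f g : (Fin n → ℂ) → ℂ} (hf : DifferentiableOn ℂ f (polydisc n))
    (hg : DifferentiableOn ℂ g (polydisc n)) {l : Fin n → ℂ} (hl : l ∈ polydisc n) :
    HasSum (fun k => conj (taylor f k * monomial k l) * (taylor g k * monomial k l))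
      (∫ w, conj (f (l * torusPt w)) * g (l * torusPt w) ∂torusMeasure n) := by
  have h := parseval_continuous ⟨_, continuous_slice hf hl⟩ ⟨_, continuous_slice hg hl⟩
  have h' := ((castInt_injective n).hasSum_iff ?_).mpr h
  · refine h'.congr_fun fun k => ?_
    rw [← coef_eq hf k hl, ← coef_eq hg k hl]
    rfl
  · intro m hm
    obtain ⟨j, hj⟩ := exists_neg_of_notMem_range hm
    have := coef_neg hg hj hl
    unfold coef at this
    simp only [ContinuousMap.coe_mk]
    rw [this, mul_zero]

theorem summable_geom (n : ℕ) {r : ℝ} (h0 : 0 ≤ r) (h1 : r < 1) :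
    Summable fun k : Fin n → ℕ => r ^ (∑ j, k j) := by
  refine summable_of_sum_le (c := ((1 - r)⁻¹) ^ n) (fun k => by positivity) fun S => ?_
  obtain ⟨N, hN⟩ : ∃ N, ∀ k ∈ S, ∀ j, k j < N := by
    refine ⟨∑ k ∈ S, ∑ j, k j + 1, fun k hk j => ?_⟩
    have a1 : k j ≤ ∑ j, k j := Finset.single_le_sum (fun _ _ => Nat.zero_le _) (Finset.mem_univ j)
    have a2 : ∑ j, k j ≤ ∑ k ∈ S, ∑ j, k j :=
      Finset.single_le_sum (f := fun k : Fin n → ℕ => ∑ j, k j) (fun _ _ => Nat.zero_le _) hk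
    omega
  calc ∑ k ∈ S, r ^ (∑ j, k j)
      ≤ ∑ k ∈ Fintype.piFinset fun _ : Fin n => Finset.range N, r ^ (∑ j, k j) := by
        refine Finset.sum_le_sum_of_subset_of_nonneg (fun k hk => ?_) (fun _ _ _ => by positivity)
        simpa using hN k hk
    _ = ∏ _j : Fin n, ∑ i ∈ Finset.range N, r ^ i := by
        rw [Finset.prod_univ_sum]
        simp_rw [Finset.prod_pow_eq_pow_sum]
    _ ≤ ((1 - r)⁻¹) ^ n := by
        rw [Finset.prod_const, Finset.card_univ, Fintype.card_fin]
        gcongr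
        rw [← tsum_geometric_of_lt_one h0 h1]
        exact (summable_geometric_of_lt_one h0 h1).sum_le_tsum _ fun _ _ => by positivity

theorem monomial_const {n : ℕ} (k : Fin n → ℕ) (r : ℂ) :
    monomial k (fun _ => r) = r ^ (∑ j, k j) := by
  simp [monomial, Finset.prod_pow_eq_pow_sum]

theorem norm_monomial_le {n : ℕ} (k : Fin n → ℕ) {z : Fin n → ℂ} {r : ℝ}
    (hz : ∀ j, ‖z j‖ ≤ r) : ‖monomial k z‖ ≤ r ^ (∑ j, k j) := by
  rw [monomial, norm_prod, ← Finset.prod_pow_eq_pow_sum]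
  refine Finset.prod_le_prod (fun _ _ => norm_nonneg _) fun j _ => ?_
  rw [norm_pow]
  exact pow_le_pow_left₀ (norm_nonneg _) (hz j) _

/-- `∫ |f(rw)|² dm(w)`. -/
def torusMean {n : ℕ} (f : (Fin n → ℂ) → ℂ) (r : ℝ) : ℝ :=
  ∫ w, ‖f (fun k => r * torusPt w k)‖ ^ 2 ∂torusMeasure n

/-- `∫ f(rw) conj(g(rw)) dm(w)`. -/
def torusPairing {n : ℕ} (f g : (Fin n → ℂ) → ℂ) (r : ℝ) : ℂ :=
  ∫ w, f (fun k => r * torusPt w k) * conj (g (fun k => r * torusPt w k)) ∂torusMeasure n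

theorem const_mem {n : ℕ} {r : ℝ} (h0 : 0 ≤ r) (h1 : r < 1) :
    (fun _ => (r : ℂ) : Fin n → ℂ) ∈ polydisc n := by
  intro k; simpa [abs_of_nonneg h0] using h1

theorem hasSum_torusPairing {n : ℕ} {f g : (Fin n → ℂ) → ℂ}
    (hf : DifferentiableOn ℂ f (polydisc n)) (hg : DifferentiableOn ℂ g (polydisc n))
    {r : ℝ} (h0 : 0 ≤ r) (h1 : r < 1) :
    HasSum (fun k => taylor f k * conj (taylor g k) * ((r ^ 2) ^ (∑ j, k j) : ℝ))
      (torusPairing f g r) := by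
  have h := parseval hg hf (const_mem (n := n) h0 h1)
  have e : torusPairing f g r = ∫ w, conj (g ((fun _ => (r : ℂ)) * torusPt w)) *
      f ((fun _ => (r : ℂ)) * torusPt w) ∂torusMeasure n := by
    refine integral_congr_ae (.of_forall fun w => ?_)
    exact mul_comm _ _
  rw [e]
  refine h.congr_fun fun k => ?_
  rw [monomial_const]
  push_cast
  simp only [map_mul, map_pow, Complex.conj_ofReal]
  ring

theorem hasSum_torusMean {n : ℕ} {f : (Fin n → ℂ) → ℂ}
    (hf : DifferentiableOn ℂ f (polydisc n)) {r : ℝ} (h0 : 0 ≤ r) (h1 : r < 1) :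
    HasSum (fun k => ‖taylor f k‖ ^ 2 * (r ^ 2) ^ (∑ j, k j)) (torusMean f r) := by
  have h := hasSum_torusPairing hf hf h0 h1
  have e : torusPairing f f r = (torusMean f r : ℂ) := by
    rw [torusMean, ← integral_complex_ofReal]
    refine integral_congr_ae (.of_forall fun w => ?_)
    simp [Complex.mul_conj, Complex.normSq_eq_norm_sq]
  rw [e] at h
  refine Complex.hasSum_ofReal.mp (h.congr_fun fun k => ?_)
  simp [Complex.mul_conj, Complex.normSq_eq_norm_sq]

theorem summable_taylor {n : ℕ} {f : (Fin n → ℂ) → ℂ}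
    (hf : DifferentiableOn ℂ f (polydisc n)) {z : Fin n → ℂ} (hz : z ∈ polydisc n) :
    Summable fun k => taylor f k * monomial k z := by
  have hz1 : ‖z‖ < 1 := by simpa [polydisc_eq_ball] using hz
  obtain ⟨r, hr, hr1⟩ := exists_between hz1
  have hr0 : 0 < r := (norm_nonneg z).trans_lt hr
  have hb : ∀ k : Fin n → ℕ, ‖taylor f k‖ * r ^ (∑ j, k j) ≤ √(torusMean f r) := by
    intro k
    refine Real.le_sqrt_of_sq_le ?_
    have := le_hasSum (hasSum_torusMean hf hr0.le hr1) k fun _ _ => by positivity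
    rwa [mul_pow, ← pow_mul, mul_comm _ 2, pow_mul]
  refine Summable.of_norm_bounded (g := fun k => √(torusMean f r) * (‖z‖ / r) ^ (∑ j, k j))
    ((summable_geom n (by positivity) ((div_lt_one hr0).mpr hr)).mul_left _) fun k => ?_
  rw [norm_mul, div_pow]
  calc ‖taylor f k‖ * ‖monomial k z‖ ≤ ‖taylor f k‖ * ‖z‖ ^ (∑ j, k j) := by
        gcongr; exact norm_monomial_le k (norm_le_pi_norm z)
    _ = (‖taylor f k‖ * r ^ (∑ j, k j)) * (‖z‖ ^ (∑ j, k j) / r ^ (∑ j, k j)) := by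
        field_simp
    _ ≤ _ := by gcongr; exact hb k

theorem torusPt_zero (n : ℕ) : torusPt (0 : UnitAddTorus (Fin n)) = 1 := by
  ext k; simp [torusPt]

/-- A holomorphic function on the polydisc is the sum of its Taylor series. -/
theorem hasSum_taylor {n : ℕ} {f : (Fin n → ℂ) → ℂ}
    (hf : DifferentiableOn ℂ f (polydisc n)) {z : Fin n → ℂ} (hz : z ∈ polydisc n) :
    HasSum (fun k => taylor f k * monomial k z) (f z) := by
  let F : C(UnitAddTorus (Fin n), ℂ) := ⟨_, continuous_slice hf hz⟩
  have e : ∀ m, UnitAddTorus.mFourierCoeff F m = coef f m z := fun m => rfl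
  have hneg : ∀ m ∉ range (castInt (n := n)), UnitAddTorus.mFourierCoeff F m = 0 := by
    intro m hm
    obtain ⟨j, hj⟩ := exists_neg_of_notMem_range hm
    rw [e, coef_neg hf hj hz]
  have hs : Summable (UnitAddTorus.mFourierCoeff F) := by
    rw [← (castInt_injective n).summable_iff hneg]
    refine (summable_taylor hf hz).congr fun k => ?_
    rw [Function.comp_apply, e, coef_eq hf k hz]
  have h := UnitAddTorus.hasSum_mFourier_series_apply_of_summable hs 0
  rw [← (castInt_injective n).hasSum_iff (fun m hm => by rw [hneg m hm, zero_smul])] at h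
  have e0 : F 0 = f z := by
    change f (z * torusPt 0) = f z
    rw [torusPt_zero, mul_one]
  rw [e0] at h
  refine h.congr_fun fun k => ?_
  rw [Function.comp_apply, e, coef_eq hf k hz]
  simp [UnitAddTorus.mFourier]

theorem summable_sq_of_bounded {n : ℕ} {f : (Fin n → ℂ) → ℂ}
    (hf : DifferentiableOn ℂ f (polydisc n)) {B : ℝ}
    (hB : ∀ᶠ r in 𝓝[<] (1 : ℝ), torusMean f r ≤ B) : Summable fun k => ‖taylor f k‖ ^ 2 := by
  refine summable_of_sum_le (c := B) (fun k => by positivity) fun S => ?_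
  have ht : Tendsto (fun r : ℝ => ∑ k ∈ S, ‖taylor f k‖ ^ 2 * (r ^ 2) ^ (∑ j, k j)) (𝓝[<] 1)
      (𝓝 (∑ k ∈ S, ‖taylor f k‖ ^ 2 * ((1 : ℝ) ^ 2) ^ (∑ j, k j))) :=
    Tendsto.mono_left (Continuous.tendsto (by fun_prop) _) nhdsWithin_le_nhds
  simp only [one_pow, mul_one] at ht
  refine le_of_tendsto ht ?_
  filter_upwards [hB, Ioo_mem_nhdsLT (zero_lt_one (α := ℝ))] with r hr hr1
  exact (sum_le_hasSum S (fun _ _ => by positivity)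
    (hasSum_torusMean hf hr1.1.le hr1.2)).trans hr

theorem tendsto_torusPairing {n : ℕ} {f g : (Fin n → ℂ) → ℂ}
    (hf : DifferentiableOn ℂ f (polydisc n)) (hg : DifferentiableOn ℂ g (polydisc n))
    (sf : Summable fun k => ‖taylor f k‖ ^ 2) (sg : Summable fun k => ‖taylor g k‖ ^ 2) :
    Tendsto (torusPairing f g) (𝓝[<] 1) (𝓝 (∑' k, taylor f k * conj (taylor g k))) := by
  have hsum : Summable fun k => ‖taylor f k‖ ^ 2 + ‖taylor g k‖ ^ 2 := sf.add sg
  have h := tendsto_tsum_of_dominated_convergence (𝓕 := 𝓝[<] (1 : ℝ))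
    (f := fun r k => taylor f k * conj (taylor g k) * ((r ^ 2) ^ (∑ j, k j) : ℝ))
    (g := fun k => taylor f k * conj (taylor g k)) hsum ?_ ?_
  · refine h.congr' ?_
    filter_upwards [Ioo_mem_nhdsLT (zero_lt_one (α := ℝ))] with r hr
    exact (hasSum_torusPairing hf hg hr.1.le hr.2).tsum_eq
  · intro k
    have : Tendsto (fun r : ℝ => taylor f k * conj (taylor g k) * ((r ^ 2) ^ (∑ j, k j) : ℝ))
        (𝓝[<] 1) (𝓝 (taylor f k * conj (taylor g k) * (((1 : ℝ) ^ 2) ^ (∑ j, k j) : ℝ))) :=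
      Tendsto.mono_left (Continuous.tendsto (by fun_prop) _) nhdsWithin_le_nhds
    simpa using this
  · filter_upwards [Ioo_mem_nhdsLT (zero_lt_one (α := ℝ))] with r hr k
    rw [norm_mul, norm_mul, RCLike.norm_conj, Complex.norm_real, Real.norm_eq_abs,
      abs_of_nonneg (by positivity)]
    have h1 : (r ^ 2) ^ (∑ j, k j) ≤ 1 := pow_le_one₀ (by positivity)
      (pow_le_one₀ hr.1.le hr.2.le)
    have h2 : 0 ≤ (r ^ 2) ^ (∑ j, k j) := by positivity
    nlinarith [mul_nonneg (norm_nonneg (taylor f k)) (norm_nonneg (taylor g k)),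
      sq_nonneg (‖taylor f k‖ - ‖taylor g k‖), sq_nonneg (‖taylor f k‖), sq_nonneg (‖taylor g k‖),
      mul_le_of_le_one_right (mul_nonneg (norm_nonneg (taylor f k)) (norm_nonneg (taylor g k))) h1]

theorem torusPairing_self {n : ℕ} (f : (Fin n → ℂ) → ℂ) (r : ℝ) :
    torusPairing f f r = (torusMean f r : ℂ) := by
  rw [torusMean, ← integral_complex_ofReal]
  refine integral_congr_ae (.of_forall fun w => ?_)
  simp [Complex.mul_conj, Complex.normSq_eq_norm_sq]

/-- `f` is a function in the Hardy space: holomorphic on `𝔻ⁿ`, with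
`lim_{r → 1⁻} ∫ |f(rw)|² dm(w)` finite. A function on `𝔻ⁿ` is encoded as its extension by zero
to `ℂⁿ`. -/
structure MemHardy {n : ℕ} (f : (Fin n → ℂ) → ℂ) : Prop where
  differentiableOn : DifferentiableOn ℂ f (polydisc n)
  eq_zero : ∀ z ∉ polydisc n, f z = 0
  exists_tendsto : ∃ L : ℝ, Tendsto (torusMean f) (𝓝[<] 1) (𝓝 L)

theorem MemHardy.summable {n : ℕ} {f : (Fin n → ℂ) → ℂ} (hf : MemHardy f) :
    Summable fun k => ‖taylor f k‖ ^ 2 := by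
  obtain ⟨L, hL⟩ := hf.exists_tendsto
  exact summable_sq_of_bounded hf.differentiableOn (hL.eventually_le_const (lt_add_one L))

theorem memHardy_of_summable {n : ℕ} {f : (Fin n → ℂ) → ℂ}
    (hf : DifferentiableOn ℂ f (polydisc n)) (h0 : ∀ z ∉ polydisc n, f z = 0)
    (hs : Summable fun k => ‖taylor f k‖ ^ 2) : MemHardy f := by
  refine ⟨hf, h0, _, ((Complex.continuous_re.tendsto _).comp
    (tendsto_torusPairing hf hf hs hs)).congr fun r => ?_⟩
  rw [Function.comp_apply, torusPairing_self, Complex.ofReal_re]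

theorem taylor_add {n : ℕ} {f g : (Fin n → ℂ) → ℂ} (hf : DifferentiableOn ℂ f (polydisc n))
    (hg : DifferentiableOn ℂ g (polydisc n)) (k : Fin n → ℕ) :
    taylor (f + g) k = taylor f k + taylor g k := by
  have hint : ∀ h : (Fin n → ℂ) → ℂ, DifferentiableOn ℂ h (polydisc n) →
      Integrable (fun w => UnitAddTorus.mFourier (-castInt k) w *
        h ((fun _ => 1 / 2) * torusPt w)) (torusMeasure n) := fun h hh =>
    ((UnitAddTorus.mFourier (-castInt k)).continuous.mul
      (continuous_slice hh (half_mem n))).integrable_of_hasCompactSupport (.of_compactSpace _)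
  simp only [taylor, coef, Pi.add_apply, mul_add]
  rw [integral_add (hint f hf) (hint g hg), add_mul]

theorem taylor_smul {n : ℕ} (c : ℂ) (f : (Fin n → ℂ) → ℂ) (k : Fin n → ℕ) :
    taylor (c • f) k = c * taylor f k := by
  simp only [taylor, coef, Pi.smul_apply, smul_eq_mul, mul_left_comm _ c]
  rw [integral_const_mul, mul_assoc]

theorem memlp_two_iff {ι : Type*} (a : ι → ℂ) :
    Memℓp a 2 ↔ Summable fun k => ‖a k‖ ^ 2 := by
  rw [memℓp_gen_iff (by norm_num)]
  simp

/-- The vector space of the functions in the Hardy space. -/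
def hardySubmodule (n : ℕ) : Submodule ℂ ((Fin n → ℂ) → ℂ) where
  carrier := {f | MemHardy f}
  zero_mem' := ⟨differentiableOn_const _, fun _ _ => rfl, 0,
    tendsto_const_nhds.congr fun r => by simp [torusMean]⟩
  add_mem' {f g} hf hg := by
    refine memHardy_of_summable (hf.differentiableOn.add hg.differentiableOn)
      (fun z hz => by simp [hf.eq_zero z hz, hg.eq_zero z hz]) ?_
    simp_rw [taylor_add hf.differentiableOn hg.differentiableOn]
    exact (memlp_two_iff _).mp
      (((memlp_two_iff _).mpr hf.summable).add ((memlp_two_iff _).mpr hg.summable))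
  smul_mem' c f hf := by
    refine memHardy_of_summable (hf.differentiableOn.const_smul c)
      (fun z hz => by simp [hf.eq_zero z hz]) ?_
    simp_rw [taylor_smul, norm_mul, mul_pow]
    exact hf.summable.mul_left _

/-- The Hardy space `H²(𝔻ⁿ)`; its inner product is defined below. -/
def HardySpace (n : ℕ) : Type := hardySubmodule n

namespace HardySpace

variable {n : ℕ}

instance : AddCommGroup (HardySpace n) := inferInstanceAs (AddCommGroup (hardySubmodule n))

instance : Module ℂ (HardySpace n) := inferInstanceAs (Module ℂ (hardySubmodule n))

instance : FunLike (HardySpace n) (Fin n → ℂ) ℂ where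
  coe f := f.1
  coe_injective _ _ h := Subtype.ext h

theorem memHardy (f : HardySpace n) : MemHardy (f : (Fin n → ℂ) → ℂ) := f.2

/-- The Taylor coefficients of an element of `H²(𝔻ⁿ)`. -/
def toL2 : HardySpace n →ₗ[ℂ] lp (fun _ : Fin n → ℕ => ℂ) 2 where
  toFun f := ⟨taylor f, (memlp_two_iff _).mpr f.memHardy.summable⟩
  map_add' f g := by
    ext k
    exact taylor_add f.memHardy.differentiableOn g.memHardy.differentiableOn k
  map_smul' c f := by
    ext k
    exact taylor_smul c f k

theorem toL2_apply (f : HardySpace n) (k : Fin n → ℕ) : toL2 f k = taylor f k := rfl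

theorem toL2_injective : Function.Injective (toL2 (n := n)) := by
  intro f g h
  refine DFunLike.ext _ _ fun z => ?_
  by_cases hz : z ∈ polydisc n
  · refine (hasSum_taylor f.memHardy.differentiableOn hz).unique ?_
    refine (hasSum_taylor g.memHardy.differentiableOn hz).congr_fun fun k => ?_
    rw [← toL2_apply, ← toL2_apply, h]
  · rw [f.memHardy.eq_zero z hz, g.memHardy.eq_zero z hz]

/-- `⟨f, g⟩ = lim_{r → 1⁻} ∫ f(rw) conj(g(rw)) dm(w)`, linear in `f` and conjugate-linear in `g`. -/
def pairing (f g : HardySpace n) : ℂ := limUnder (𝓝[<] 1) (torusPairing f g)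

theorem pairing_eq_inner (f g : HardySpace n) : pairing f g = inner ℂ (toL2 g) (toL2 f) :=
  (tendsto_torusPairing f.memHardy.differentiableOn g.memHardy.differentiableOn
    f.memHardy.summable g.memHardy.summable).limUnder_eq

/-- The inner product of `H²(𝔻ⁿ)`; in Mathlib it is conjugate-linear in the first argument. -/
@[reducible] def core : InnerProductSpace.Core ℂ (HardySpace n) where
  inner g f := pairing f g
  conj_inner_symm f g := by simp only [pairing_eq_inner, inner_conj_symm]
  re_inner_nonneg f := by simp only [pairing_eq_inner]; exact inner_self_nonneg
  add_left f g h := by simp only [pairing_eq_inner, map_add, inner_add_left]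
  smul_left f g c := by simp only [pairing_eq_inner, map_smul, inner_smul_left]
  definite f h := by
    rw [pairing_eq_inner, inner_self_eq_zero] at h
    exact toL2_injective (h.trans (map_zero _).symm)

instance : NormedAddCommGroup (HardySpace n) := core.toNormedAddCommGroup

instance : InnerProductSpace ℂ (HardySpace n) := .ofCore core.toCore

theorem inner_eq (f g : HardySpace n) : inner ℂ f g = inner ℂ (toL2 f) (toL2 g) :=
  pairing_eq_inner g f

theorem norm_toL2 (f : HardySpace n) : ‖toL2 f‖ = ‖f‖ := by
  rw [@norm_eq_sqrt_re_inner ℂ, @norm_eq_sqrt_re_inner ℂ, inner_eq]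

theorem monomial_mul_torusPt (k : Fin n → ℕ) (l : Fin n → ℂ) (w : UnitAddTorus (Fin n)) :
    monomial k (l * torusPt w) = monomial k l * UnitAddTorus.mFourier (castInt k) w := by
  have hpow : ∀ (i : ℕ) (u : UnitAddCircle), (fourier 1 u : ℂ) ^ i = fourier (i : ℤ) u := by
    intro i u
    induction i with
    | zero => simp
    | succ i ih => rw [pow_succ, ih, Nat.cast_succ, fourier_add]
  simp only [monomial, Pi.mul_apply, mul_pow, Finset.prod_mul_distrib, torusPt,
    UnitAddTorus.mFourier, ContinuousMap.coe_mk, castInt_apply, hpow]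

theorem integral_mFourier (m : Fin n → ℤ) :
    ∫ w, UnitAddTorus.mFourier m w ∂torusMeasure n = if m = 0 then 1 else 0 := by
  simp only [UnitAddTorus.mFourier, ContinuousMap.coe_mk]
  rw [integral_fintype_prod_eq_prod (fun i (u : UnitAddCircle) => (fourier (m i) u : ℂ))]
  simp_rw [integral_fourier_haar]
  split_ifs with h
  · simp [h]
  · obtain ⟨j, hj⟩ := Function.ne_iff.mp h
    exact Finset.prod_eq_zero (Finset.mem_univ j) (if_neg hj)

theorem differentiable_monomial (k : Fin n → ℕ) : Differentiable ℂ (monomial k) := by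
  unfold monomial; fun_prop

/-- A power series with bounded coefficients is holomorphic on the polydisc. -/
theorem differentiableOn_series {a : (Fin n → ℕ) → ℂ} {C : ℝ} (hC : ∀ k, ‖a k‖ ≤ C) :
    DifferentiableOn ℂ (fun z => ∑' k, a k * monomial k z) (polydisc n) := by
  intro z hz
  have hz1 : ‖z‖ < 1 := by simpa [polydisc_eq_ball] using hz
  have hC0 : 0 ≤ C := (norm_nonneg _).trans (hC 0)
  obtain ⟨r, hr, hr1⟩ := exists_between hz1
  obtain ⟨q, hq, hq1⟩ := exists_between hr1
  have hr0 : 0 ≤ r := (norm_nonneg z).trans hr.le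
  have hq0 : 0 ≤ q := hr0.trans hq.le
  refine DifferentiableAt.differentiableWithinAt
    (hasFDerivAt_tsum_of_isPreconnected (s := Metric.ball 0 r) (x₀ := 0)
    (f' := fun k y => fderiv ℂ (fun z => a k * monomial k z) y)
    (u := fun k => 2 * C / (q - r) * q ^ (∑ j, k j))
    ((summable_geom n hq0 hq1).mul_left _) Metric.isOpen_ball
    (convex_ball _ _).isPreconnected ?_ ?_ ?_ ?_ ?_).differentiableAt
  · intro k x _
    exact ((differentiable_monomial k).const_mul (a k) x).hasFDerivAt
  · intro k x hx
    have hb : ∀ y ∈ Metric.ball x (q - r), ‖a k * monomial k y‖ ≤ C * q ^ (∑ j, k j) := by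
      intro y hy
      have hy' : ‖y‖ ≤ q := by
        have h1 : ‖y‖ ≤ ‖y - x‖ + ‖x‖ := by simpa using norm_add_le (y - x) x
        rw [mem_ball_iff_norm] at hy
        rw [mem_ball_zero_iff] at hx
        linarith
      rw [norm_mul]
      exact mul_le_mul (hC k) (norm_monomial_le k fun j => (norm_le_pi_norm y j).trans hy')
        (norm_nonneg _) hC0
    have hqr : 0 < q - r := sub_pos.mpr hq
    refine (Complex.norm_fderiv_le_div_of_mapsTo_ball (R₁ := q - r)
      (R₂ := 2 * C * q ^ (∑ j, k j))
      ((differentiable_monomial k).const_mul (a k)).differentiableOn ?_ hqr).trans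
      (le_of_eq (by ring))
    intro y hy
    rw [mem_closedBall_iff_norm]
    refine (norm_sub_le _ _).trans ?_
    linarith [hb y hy, hb x (Metric.mem_ball_self hqr)]
  · exact Metric.mem_ball_self ((norm_nonneg z).trans_lt hr)
  · refine summable_of_ne_finset_zero (s := {0}) fun k hk => ?_
    rw [Finset.mem_singleton] at hk
    obtain ⟨j, hj⟩ := Function.ne_iff.mp hk
    rw [monomial, Finset.prod_eq_zero (Finset.mem_univ j) (by simpa using hj), mul_zero]
  · simpa using hr

theorem taylor_series {a : (Fin n → ℕ) → ℂ} {C : ℝ} (hC : ∀ k, ‖a k‖ ≤ C)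
    {f : (Fin n → ℂ) → ℂ} (hf : ∀ z ∈ polydisc n, f z = ∑' k, a k * monomial k z)
    (k : Fin n → ℕ) : taylor f k = a k := by
  set l : Fin n → ℂ := fun _ => 1 / 2 with hl
  have hlm : l ∈ polydisc n := half_mem n
  have hs : Summable fun i => ‖a i * monomial i l‖ := by
    refine Summable.of_nonneg_of_le (fun _ => norm_nonneg _) (fun i => ?_)
      ((summable_geom n (r := 1 / 2) (by norm_num) (by norm_num)).mul_left C)
    rw [norm_mul]
    exact mul_le_mul (hC i) (norm_monomial_le i fun j => by simp [hl]) (norm_nonneg _)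
      ((norm_nonneg _).trans (hC 0))
  have hF : ∀ (i : Fin n → ℕ) (w : UnitAddTorus (Fin n)),
      UnitAddTorus.mFourier (-castInt k) w * (a i * monomial i (l * torusPt w))
        = a i * monomial i l * UnitAddTorus.mFourier (-castInt k + castInt i) w := by
    intro i w
    rw [monomial_mul_torusPt, UnitAddTorus.mFourier_add]; ring
  have hn : ∀ (m : Fin n → ℤ) (w : UnitAddTorus (Fin n)), ‖UnitAddTorus.mFourier m w‖ = 1 := by
    intro m w
    simp only [UnitAddTorus.mFourier, ContinuousMap.coe_mk, norm_prod, norm_fourier_apply,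
      Finset.prod_const_one]
  have hS := hasSum_integral_of_summable_integral_norm (μ := torusMeasure n)
    (F := fun i w => UnitAddTorus.mFourier (-castInt k) w * (a i * monomial i (l * torusPt w)))
    ?_ ?_
  · simp_rw [hF, integral_const_mul, integral_mFourier] at hS
    have h1 := hS.unique (hasSum_single k fun i hi => by
      rw [if_neg, mul_zero]
      intro h
      exact hi (castInt_injective n (neg_add_eq_zero.mp h).symm))
    rw [if_pos (neg_add_cancel _), mul_one] at h1
    have h2 : coef f (castInt k) l = a k * monomial k l := by
      rw [← h1]
      refine integral_congr_ae (.of_forall fun w => ?_)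
      simp only
      rw [hf _ (mul_torusPt_mem hlm w), ← tsum_mul_left]
      exact tsum_congr fun i => hF i w
    rw [taylor, h2, hl, monomial_const, mul_assoc, ← mul_pow]
    norm_num
  · intro i
    simp_rw [hF]
    exact ((UnitAddTorus.mFourier _).continuous.const_mul _).integrable_of_hasCompactSupport
      (.of_compactSpace _)
  · simp_rw [hF, norm_mul _ (UnitAddTorus.mFourier _ _), hn]
    simpa using hs

theorem toL2_surjective : Function.Surjective (toL2 (n := n)) := by
  classical
  intro a
  have hC : ∀ k, ‖a k‖ ≤ ‖a‖ := fun k => lp.norm_apply_le_norm (by norm_num) a k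
  set f : (Fin n → ℂ) → ℂ := (polydisc n).indicator fun z => ∑' k, a k * monomial k z with hf
  have hfz : ∀ z ∈ polydisc n, f z = ∑' k, a k * monomial k z := fun z hz =>
    indicator_of_mem hz _
  have ht : ∀ k, taylor f k = a k := taylor_series hC hfz
  have hmem : MemHardy f := by
    refine memHardy_of_summable ((differentiableOn_series hC).congr hfz)
      (fun z hz => indicator_of_notMem hz _) ?_
    simp_rw [ht]
    exact (memlp_two_iff _).mp a.2
  refine ⟨⟨f, hmem⟩, ?_⟩
  ext k
  exact ht k

/-- The Taylor coefficients identify `H²(𝔻ⁿ)` with `ℓ²(ℕⁿ)`. -/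
def toL2Equiv : HardySpace n ≃ₗᵢ[ℂ] lp (fun _ : Fin n → ℕ => ℂ) 2 :=
  ⟨LinearEquiv.ofBijective toL2 ⟨toL2_injective, toL2_surjective⟩, norm_toL2⟩

instance : CompleteSpace (HardySpace n) :=
  (completeSpace_congr (e := (toL2Equiv (n := n)).toEquiv)
    (toL2Equiv (n := n)).isometry.isUniformInducing.isUniformEmbedding).mpr inferInstance

/-- Bounded holomorphic functions belong to the Hardy space. -/
theorem _root_.PolydiscKoopman.memHardy_of_bounded {f : (Fin n → ℂ) → ℂ}
    (hf : DifferentiableOn ℂ f (polydisc n)) (h0 : ∀ z ∉ polydisc n, f z = 0) {C : ℝ}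
    (hC : ∀ z ∈ polydisc n, ‖f z‖ ≤ C) : MemHardy f := by
  refine memHardy_of_summable hf h0 (summable_sq_of_bounded (B := C ^ 2) hf ?_)
  filter_upwards [Ioo_mem_nhdsLT (zero_lt_one (α := ℝ))] with r hr
  have hm := const_mem (n := n) hr.1.le hr.2
  have hint : Integrable (fun w => ‖f ((fun _ => (r : ℂ)) * torusPt w)‖ ^ 2) (torusMeasure n) :=
    ((continuous_slice hf hm).norm.pow 2).integrable_of_hasCompactSupport (.of_compactSpace _)
  refine (integral_mono hint (integrable_const (C ^ 2)) fun w => ?_).trans (by simp)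
  exact pow_le_pow_left₀ (norm_nonneg _) (hC _ (mul_torusPt_mem hm w)) 2

end HardySpace

/-! ### The reproducing functions -/

/-- `k_{z₀}(z) = ∏ i, 1 / (1 - conj(z₀ᵢ) zᵢ)` on the polydisc. -/
def kernelFun {n : ℕ} (z₀ : Fin n → ℂ) : (Fin n → ℂ) → ℂ :=
  (polydisc n).indicator fun z => ∏ i, 1 / (1 - conj (z₀ i) * z i)

theorem memHardy_kernelFun {n : ℕ} {z₀ : Fin n → ℂ} (hz₀ : z₀ ∈ polydisc n) :
    MemHardy (kernelFun z₀) := by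
  have hlow : ∀ z ∈ polydisc n, ∀ i, 1 - ‖z₀ i‖ ≤ ‖1 - conj (z₀ i) * z i‖ := by
    intro z hz i
    have h1 := norm_sub_norm_le (1 : ℂ) (conj (z₀ i) * z i)
    rw [norm_one, norm_mul, RCLike.norm_conj] at h1
    nlinarith [norm_nonneg (z₀ i), hz i]
  have hpos : ∀ i, 0 < 1 - ‖z₀ i‖ := fun i => sub_pos.mpr (hz₀ i)
  refine memHardy_of_bounded (C := ∏ i, 1 / (1 - ‖z₀ i‖)) ?_
    (fun z hz => indicator_of_notMem hz _) fun z hz => ?_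
  · have hd : ∀ i, DifferentiableOn ℂ (fun z : Fin n → ℂ => 1 / (1 - conj (z₀ i) * z i))
        (polydisc n) := by
      intro i
      have h1 : Differentiable ℂ fun z : Fin n → ℂ => 1 - conj (z₀ i) * z i :=
        ((differentiable_apply i).const_mul _).const_sub _
      simp_rw [one_div]
      exact h1.differentiableOn.inv fun z hz =>
        norm_pos_iff.mp ((hpos i).trans_le (hlow z hz i))
    have hp : DifferentiableOn ℂ (fun z : Fin n → ℂ => ∏ i, 1 / (1 - conj (z₀ i) * z i))
        (polydisc n) := fun z hz =>
      (HasFDerivWithinAt.finsetProd fun i _ =>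
        (hd i z hz).hasFDerivWithinAt).differentiableWithinAt
    exact hp.congr fun z hz => by rw [kernelFun, indicator_of_mem hz]
  · rw [kernelFun, indicator_of_mem hz, norm_prod]
    refine Finset.prod_le_prod (fun _ _ => norm_nonneg _) fun i _ => ?_
    rw [norm_div, norm_one]
    exact one_div_le_one_div_of_le (hpos i) (hlow z hz i)

/-- The reproducing function `k_{z₀}`, as an element of `H²(𝔻ⁿ)`. -/
def kernel {n : ℕ} (z₀ : polydisc n) : HardySpace n := ⟨kernelFun z₀, memHardy_kernelFun z₀.2⟩

/-! ### The dynamics -/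

/-- The vector field `F` is holomorphic on `𝔻ⁿ` and continuous on `𝔻ⁿ ∪ 𝕋ⁿ`, and generates the
forward flow `φ` on `𝔻ⁿ`, by holomorphic maps. The value `φ t z` at `z ∈ 𝕋ⁿ` is the one of
the continuous extension of the time-`t` map to `𝔻ⁿ ∪ 𝕋ⁿ`. Only times `t ≥ 0` matter. -/
structure IsHolomorphicFlow {n : ℕ} (F : (Fin n → ℂ) → Fin n → ℂ)
    (φ : ℝ → (Fin n → ℂ) → Fin n → ℂ) : Prop where
  differentiableOn_field : DifferentiableOn ℂ F (polydisc n)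
  continuousOn_field : ContinuousOn F (polydisc n ∪ torus n)
  mapsTo : ∀ t, 0 ≤ t → MapsTo (φ t) (polydisc n) (polydisc n)
  map_zero : ∀ z ∈ polydisc n, φ 0 z = z
  map_add : ∀ t, 0 ≤ t → ∀ s, 0 ≤ s → ∀ z ∈ polydisc n, φ (t + s) z = φ t (φ s z)
  hasDeriv : ∀ z ∈ polydisc n, ∀ t, 0 ≤ t →
    HasDerivWithinAt (fun s => φ s z) (F (φ t z)) (Ici 0) t
  differentiableOn_flow : ∀ t, 0 ≤ t → DifferentiableOn ℂ (φ t) (polydisc n)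
  continuousOn_flow : ∀ t, 0 ≤ t → ContinuousOn (φ t) (polydisc n ∪ torus n)

/-- For `t > 0` the flow maps the torus `𝕋ⁿ` into a polydisc of radius `R_t < 1`. -/
def MapsTorusInside {n : ℕ} (φ : ℝ → (Fin n → ℂ) → Fin n → ℂ) : Prop :=
  ∀ t, 0 < t → ∃ R : ℝ, 0 < R ∧ R < 1 ∧ ∀ z ∈ torus n, ∀ j, ‖φ t z j‖ < R

/-! ### Koopman operators and their generator -/

/-- `K` is the composition operator `f ↦ f ∘ ψ` on `H²(𝔻ⁿ)`. -/
def IsCompositionOperator {n : ℕ} (ψ : (Fin n → ℂ) → Fin n → ℂ)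
    (K : HardySpace n →L[ℂ] HardySpace n) : Prop :=
  ∀ f : HardySpace n, ∀ z ∈ polydisc n, K f z = f (ψ z)

/-- `F · ∇f = ∑ k, F_k ∂f/∂z_k` on the polydisc. -/
def fieldDeriv {n : ℕ} (F : (Fin n → ℂ) → Fin n → ℂ) (f : (Fin n → ℂ) → ℂ) :
    (Fin n → ℂ) → ℂ :=
  (polydisc n).indicator fun z => ∑ k, F z k * fderiv ℂ f z (Pi.single k 1)

theorem fieldDeriv_add {n : ℕ} (F : (Fin n → ℂ) → Fin n → ℂ) (f g : HardySpace n) :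
    fieldDeriv F ⇑(f + g) = fieldDeriv F ⇑f + fieldDeriv F ⇑g := by
  ext z
  by_cases hz : z ∈ polydisc n
  · have hd : ∀ h : HardySpace n, DifferentiableAt ℂ h z := fun h =>
      h.memHardy.differentiableOn.differentiableAt ((isOpen_polydisc n).mem_nhds hz)
    have e : fderiv ℂ ⇑(f + g) z = fderiv ℂ ⇑f z + fderiv ℂ ⇑g z := fderiv_add (hd f) (hd g)
    simp [fieldDeriv, hz, e, mul_add, Finset.sum_add_distrib]
  · simp [fieldDeriv, hz]

theorem fieldDeriv_smul {n : ℕ} (F : (Fin n → ℂ) → Fin n → ℂ) (c : ℂ) (f : HardySpace n) :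
    fieldDeriv F ⇑(c • f) = c • fieldDeriv F ⇑f := by
  ext z
  by_cases hz : z ∈ polydisc n
  · have hd : DifferentiableAt ℂ f z :=
      f.memHardy.differentiableOn.differentiableAt ((isOpen_polydisc n).mem_nhds hz)
    have e : fderiv ℂ ⇑(c • f) z = c • fderiv ℂ ⇑f z := fderiv_const_smul hd c
    simp [fieldDeriv, hz, e, Finset.mul_sum, mul_left_comm]
  · simp [fieldDeriv, hz]

/-- The operator `A_F f = F · ∇f` with domain `{f ∈ H²(𝔻ⁿ) | F · ∇f ∈ H²(𝔻ⁿ)}`. -/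
def koopmanGenerator {n : ℕ} (F : (Fin n → ℂ) → Fin n → ℂ) :
    HardySpace n →ₗ.[ℂ] HardySpace n where
  domain :=
    { carrier := {f | MemHardy (fieldDeriv F f)}
      zero_mem' := by
        have h := fieldDeriv_smul F 0 0
        rw [zero_smul, zero_smul] at h
        change MemHardy (fieldDeriv F ⇑(0 : HardySpace n))
        rw [h]
        exact (hardySubmodule n).zero_mem
      add_mem' := fun {f g} hf hg => by
        change MemHardy (fieldDeriv F ⇑(f + g))
        rw [fieldDeriv_add]
        exact (hardySubmodule n).add_mem hf hg
      smul_mem' := fun c f hf => by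
        change MemHardy (fieldDeriv F ⇑(c • f))
        rw [fieldDeriv_smul]
        exact (hardySubmodule n).smul_mem c hf }
  toFun :=
    { toFun := fun f => ⟨fieldDeriv F f.1, f.2⟩
      map_add' := fun f g => Subtype.ext (fieldDeriv_add F f.1 g.1)
      map_smul' := fun c f => Subtype.ext (fieldDeriv_smul F c f.1) }

/-! ### Pseudo-weak solutions -/

/-- `f` is a pseudo-weak solution of `f' = A f + Γ`, `f(0) = f₀` on `[0, ∞)`. The inner product
`⟨u, g⟩` that is linear in `u` is `inner ℂ g u`. -/
structure IsPseudoWeakSolution {X : Type*} [NormedAddCommGroup X] [InnerProductSpace ℂ X]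
    [CompleteSpace X] (A : X →ₗ.[ℂ] X) (Γ : ℝ → X) (f₀ : X) (f : ℝ → X) : Prop where
  initial : f 0 = f₀
  continuousOn : ∀ τ, 0 < τ → ContinuousOn f (Icc 0 τ)
  absolutelyContinuous : ∀ g : A.adjoint.domain, ∀ τ, 0 < τ →
    AbsolutelyContinuousOnInterval (fun t => inner ℂ (g : X) (f t)) 0 τ
  hasDeriv : ∀ g : A.adjoint.domain, ∀ t, 0 ≤ t →
    HasDerivWithinAt (fun s => inner ℂ (g : X) (f s))
      (inner ℂ (A.adjoint g) (f t) + inner ℂ (g : X) (Γ t)) (Ici 0) t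

end PolydiscKoopman

end

open PolydiscKoopman

namespace PolydiscKoopman

open MeasureTheory Filter Topology Set
open scoped ComplexConjugate

variable {n : ℕ}

/-! ### The maximum principle for the distinguished boundary -/

/-! Everything is tested on two total families: the reproducing functions `kernel z`, on which
adjoints can be computed, and the monomials `hardyMonomial k`, which behave well under `A_F` and
under the flow.

The maximum principle `norm_le_of_norm_le_on_torus` makes `F` bounded on `𝔻ⁿ` and carries the bound
`R_t < 1` from `𝕋ⁿ` to `𝔻ⁿ`. Point evaluations are uniformly bounded on a smaller polydisc, so `f ∘
φᵗ` is a bounded function and `K(t)` is a bounded operator. Since `f ↦ f(z)` and `f ↦ Df(z)F(z)` are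
continuous, `A_F` is closed. Its domain contains the monomials because `F` is bounded. The kernels
lie in the domain of `A_F^*`, and pairing with them shows that `A_F^**` still acts as `F · ∇`
(`adjoint_adjoint_apply`).

Existence: the pairing of `g` with `k_{φᵗ(x₀)}` is the conjugate of `g(φᵗ(x₀))`. By the chain rule
its time derivative is the conjugate of `(F · ∇g)(φᵗ(x₀))`, which is the pairing of `A_F^** g` with
`k_{φᵗ(x₀)}`.

Uniqueness is a duality argument. For a solution `f` and a monomial `g`, pair `f(s)` with `K(T -
s)g`. The two contributions to the right derivative cancel, because `A_F` commutes with `K(T - s)`,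
so the pairing is constant. Comparing `s = 0` with `s = T` gives the coefficients of `f(T)`. The
derivative in the moving slot is only a weak limit: `exists_norm_koopman_hardyMonomial_sub_le`
bounds the difference quotients, and `tendsto_inner_of_bounded_of_tendsto_apply` turns their
pointwise convergence into convergence of the pairing. -/

theorem mem_polydisc_iff_norm {z : Fin n → ℂ} : z ∈ polydisc n ↔ ‖z‖ < 1 := by
  rw [polydisc_eq_ball, mem_ball_zero_iff]

/-- The maximum principle on the polydisc of radius `r < 1`, with respect to its torus. -/
theorem norm_le_of_norm_le_on_torus_radius {E : Type*} [NormedAddCommGroup E] [NormedSpace ℂ E]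
    {f : (Fin n → ℂ) → E} (hf : DifferentiableOn ℂ f (polydisc n)) {r C : ℝ} (hr0 : 0 < r)
    (hr1 : r < 1) (hC : ∀ z : Fin n → ℂ, (∀ j, ‖z j‖ = r) → ‖f z‖ ≤ C) {z : Fin n → ℂ}
    (hz : ∀ j, ‖z j‖ ≤ r) : ‖f z‖ ≤ C := by
  -- `S` holds the coordinates not yet known to have modulus `r`. The one-variable maximum principle
  -- in `z j` pushes them to the circle one at a time.
  have key : ∀ S : Finset (Fin n), ∀ z : Fin n → ℂ, (∀ j, ‖z j‖ ≤ r) →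
      (∀ j ∉ S, ‖z j‖ = r) → ‖f z‖ ≤ C := by
    intro S
    induction S using Finset.induction_on with
    | empty => exact fun z _ h => hC z fun j => h j (Finset.notMem_empty j)
    | insert j S hj ih =>
      intro z hz hzS
      have hd : DifferentiableOn ℂ (fun t : ℂ => f (Function.update z j t))
          (Metric.ball 0 1) := by
        refine hf.comp (t := polydisc n) ?_ ?_
        · intro t _
          exact (hasFDerivAt_update z t).differentiableAt.differentiableWithinAt
        · intro t ht k
          by_cases hk : k = j
          · subst hk; simpa using ht
          · simpa [hk] using (hz k).trans_lt hr1
      have h := Complex.norm_le_of_forall_mem_frontier_norm_le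
        (f := fun t : ℂ => f (Function.update z j t)) (U := Metric.ball 0 r) (C := C) (z := z j)
        Metric.isBounded_ball ?_ ?_ ?_
      · simpa using h
      · refine (hd.mono ?_).diffContOnCl
        rw [closure_ball _ hr0.ne']
        exact Metric.closedBall_subset_ball hr1
      · intro t ht
        rw [frontier_ball _ hr0.ne', mem_sphere_zero_iff_norm] at ht
        refine ih _ (fun k => ?_) fun k hk => ?_
        · by_cases hkj : k = j
          · subst hkj; simpa using ht.le
          · simpa [hkj] using hz k
        · by_cases hkj : k = j
          · subst hkj; simpa using ht
          · simpa [hkj] using hzS k (by simp [hkj, hk])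
      · rw [closure_ball _ hr0.ne']
        simpa using hz j
  exact key Finset.univ z hz fun j hj => absurd (Finset.mem_univ j) hj

theorem isCompact_torus (n : ℕ) : IsCompact (torus n) := by
  have h : torus n = Set.univ.pi fun _ => Metric.sphere (0 : ℂ) 1 := by
    ext z; simp [torus, Set.mem_pi]
  rw [h]
  exact isCompact_univ_pi fun _ => isCompact_sphere _ _

/-- The maximum principle on `𝔻ⁿ` for functions that are continuous on `𝔻ⁿ ∪ 𝕋ⁿ`. -/
theorem norm_le_of_norm_le_on_torus {E : Type*} [NormedAddCommGroup E] [NormedSpace ℂ E]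
    {f : (Fin n → ℂ) → E} (hf : DifferentiableOn ℂ f (polydisc n))
    (hc : ContinuousOn f (polydisc n ∪ torus n)) {C : ℝ} (hC : ∀ z ∈ torus n, ‖f z‖ ≤ C)
    {z : Fin n → ℂ} (hz : z ∈ polydisc n) : ‖f z‖ ≤ C := by
  refine le_of_forall_pos_le_add fun ε hε => ?_
  have hscale : ∀ r : ℝ, 0 < r → r ≤ 1 → ∀ w ∈ torus n,
      (r : ℂ) • w ∈ polydisc n ∪ torus n := by
    intro r h0 h1 w hw
    rcases h1.eq_or_lt with h | h
    · right; simpa [h] using hw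
    · left; intro k; simpa [hw k, abs_of_pos h0] using h
  have hcont : ContinuousOn (fun p : ℝ × (Fin n → ℂ) => ‖f ((p.1 : ℂ) • p.2)‖)
      (Ioc 0 1 ×ˢ torus n) :=
    (hc.comp (by fun_prop) fun p hp => hscale _ hp.1.1 hp.1.2 _ hp.2).norm
  -- Compactness of the torus gives one neighbourhood of `r = 1` that serves all `w` at once.
  have hev := (isCompact_torus n).eventually_forall_of_forall_eventually (x₀ := (1 : ℝ))
    (P := fun r w => r ∈ Ioc (0 : ℝ) 1 → w ∈ torus n → ‖f ((r : ℂ) • w)‖ < C + ε) fun w hw => by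
      have h1 := hcont (1, w) ⟨by simp, hw⟩
      have h2 : ∀ᶠ p in 𝓝[Ioc 0 1 ×ˢ torus n] ((1 : ℝ), w), ‖f ((p.1 : ℂ) • p.2)‖ < C + ε := by
        refine h1.eventually_lt_const ?_
        simpa using (hC w hw).trans_lt (lt_add_of_pos_right C hε)
      rw [eventually_nhdsWithin_iff] at h2
      exact h2.mono fun p hp ha hb => hp ⟨ha, hb⟩
  have hz1 : max ‖z‖ 0 < 1 := max_lt (mem_polydisc_iff_norm.mp hz) one_pos
  obtain ⟨r, hr, hr1⟩ := ((hev.filter_mono nhdsWithin_le_nhds).and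
    (Ioo_mem_nhdsLT hz1)).exists
  have hr0 : 0 < r := (le_max_right _ _).trans_lt hr1.1
  refine norm_le_of_norm_le_on_torus_radius hf hr0 hr1.2 (fun w hw => ?_)
    (fun j => (norm_le_pi_norm z j).trans ((le_max_left _ _).trans_lt hr1.1).le)
  have hw' : (r : ℂ)⁻¹ • w ∈ torus n := by
    intro k; simp [hw k, abs_of_pos hr0, hr0.ne']
  have := hr _ hw' ⟨hr0, hr1.2.le⟩ hw'
  rw [smul_smul, mul_inv_cancel₀ (by exact_mod_cast hr0.ne'), one_smul] at this
  exact this.le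

/-- For `n ≥ 2` the set `𝔻ⁿ ∪ 𝕋ⁿ` is not compact, so continuity alone gives no bound on it. The
bound comes from the compact torus and moves inside by the maximum principle. -/
theorem exists_norm_le_of_continuousOn {E : Type*} [NormedAddCommGroup E] [NormedSpace ℂ E]
    {f : (Fin n → ℂ) → E} (hf : DifferentiableOn ℂ f (polydisc n))
    (hc : ContinuousOn f (polydisc n ∪ torus n)) :
    ∃ C, 0 ≤ C ∧ ∀ z ∈ polydisc n, ‖f z‖ ≤ C := by
  obtain ⟨C, hC⟩ := (isCompact_torus n).exists_bound_of_continuousOn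
    (hc.mono subset_union_right)
  exact ⟨max C 0, le_max_right _ _, fun z hz => norm_le_of_norm_le_on_torus hf hc
    (fun w hw => (hC w hw).trans (le_max_left _ _)) hz⟩

/-! ### The reproducing property -/

namespace HardySpace

/-- The squared norm is the limit of the torus means, each of which is at most `C ^ 2`. -/
theorem norm_le_of_bounded (f : HardySpace n) {C : ℝ} (hC0 : 0 ≤ C)
    (hC : ∀ z ∈ polydisc n, ‖f z‖ ≤ C) : ‖f‖ ≤ C := by
  have h := tendsto_torusPairing f.memHardy.differentiableOn f.memHardy.differentiableOn
    f.memHardy.summable f.memHardy.summable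
  have h1 : inner ℂ f f = ∑' k, taylor f k * conj (taylor f k) := h.limUnder_eq
  rw [← h1, inner_self_eq_norm_sq_to_K] at h
  have h2 := (Complex.continuous_re.tendsto _).comp h
  refine abs_le_of_sq_le_sq' ?_ hC0 |>.2
  have h3 : Complex.re (((‖f‖ : ℝ) : ℂ) ^ 2) = ‖f‖ ^ 2 := by
    rw [← Complex.ofReal_pow, Complex.ofReal_re]
  rw [← h3]
  refine le_of_tendsto h2 ?_
  filter_upwards [Ioo_mem_nhdsLT (zero_lt_one (α := ℝ))] with r hr
  rw [Function.comp_apply, torusPairing_self, Complex.ofReal_re]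
  have hm := const_mem (n := n) hr.1.le hr.2
  have hint : Integrable (fun w => ‖f ((fun _ => (r : ℂ)) * torusPt w)‖ ^ 2) (torusMeasure n) :=
    ((continuous_slice f.memHardy.differentiableOn hm).norm.pow 2).integrable_of_hasCompactSupport
      (.of_compactSpace _)
  refine (integral_mono hint (integrable_const (C ^ 2)) fun w => ?_).trans (by simp)
  exact pow_le_pow_left₀ (norm_nonneg _) (hC _ (mul_torusPt_mem hm w)) 2

end HardySpace

/-- Cubes are cofinal among the finite sets of multi-indices, so an unconditional sum can be
computed along them. There it factors into one-variable sums. -/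
theorem tendsto_piFinset_range :
    Tendsto (fun N : ℕ => Fintype.piFinset fun _ : Fin n => Finset.range N) atTop atTop := by
  refine tendsto_atTop_finset_of_monotone
    (fun a b hab => Fintype.piFinset_subset _ _ fun _ => Finset.range_mono hab)
    fun k => ⟨∑ j, k j + 1, ?_⟩
  rw [Fintype.mem_piFinset]
  exact fun j => Finset.mem_range.mpr (Nat.lt_succ_of_le
    (Finset.single_le_sum (fun _ _ => Nat.zero_le _) (Finset.mem_univ j)))

/-- The geometric series in several variables. -/
theorem hasSum_monomial {x : Fin n → ℂ} (hx : x ∈ polydisc n) :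
    HasSum (fun k => monomial k x) (∏ i, 1 / (1 - x i)) := by
  have hs : Summable fun k => monomial k x :=
    Summable.of_norm_bounded
      (summable_geom n (norm_nonneg x) (mem_polydisc_iff_norm.mp hx))
      fun k => norm_monomial_le k (norm_le_pi_norm x)
  have h1 := hs.hasSum.comp tendsto_piFinset_range
  have h2 : Tendsto (fun N : ℕ => ∏ i, ∑ m ∈ Finset.range N, x i ^ m) atTop
      (𝓝 (∏ i, 1 / (1 - x i))) := by
    refine tendsto_finsetProd _ fun i _ => ?_
    rw [one_div]
    exact (hasSum_geometric_of_norm_lt_one (hx i)).tendsto_sum_nat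
  have h3 := tendsto_nhds_unique h1 (h2.congr fun N => Finset.prod_univ_sum _ _)
  exact h3 ▸ hs.hasSum

theorem monomial_mul (k : Fin n → ℕ) (z w : Fin n → ℂ) :
    monomial k (z * w) = monomial k z * monomial k w := by
  simp [monomial, mul_pow, Finset.prod_mul_distrib]

theorem monomial_conj (k : Fin n → ℕ) (z : Fin n → ℂ) :
    monomial k (fun i => conj (z i)) = conj (monomial k z) := by
  simp [monomial]

theorem norm_monomial_le_one (k : Fin n → ℕ) {z : Fin n → ℂ} (hz : z ∈ polydisc n) :
    ‖monomial k z‖ ≤ 1 :=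
  (norm_monomial_le k fun j => (hz j).le).trans_eq (one_pow _)

theorem kernel_apply (z w : polydisc n) :
    kernel z w.1 = ∏ i, 1 / (1 - conj (z.1 i) * w.1 i) :=
  indicator_of_mem w.2 fun y => ∏ i, 1 / (1 - conj (z.1 i) * y i)

/-- The kernel is a geometric series in the variables `conj (zᵢ) wᵢ`, and its coefficients are
bounded by `1`, so they can be read off. -/
theorem taylor_kernel (z : polydisc n) (k : Fin n → ℕ) :
    taylor (kernel z) k = conj (monomial k z.1) := by
  refine HardySpace.taylor_series (a := fun k => conj (monomial k z.1)) (C := 1)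
    (fun k => ?_) (fun w hw => ?_) k
  · rw [RCLike.norm_conj]; exact norm_monomial_le_one k z.2
  · have hx : (fun i => conj (z.1 i)) * w ∈ polydisc n := by
      intro i
      rw [Pi.mul_apply, norm_mul, RCLike.norm_conj]
      exact mul_lt_one_of_nonneg_of_lt_one_left (norm_nonneg _) (z.2 i) (hw i).le
    rw [kernel_apply z ⟨w, hw⟩]
    refine ((hasSum_monomial hx).tsum_eq).symm.trans (tsum_congr fun k => ?_)
    rw [monomial_mul, monomial_conj]

/-- The reproducing property of `k_z`. -/
theorem inner_kernel (z : polydisc n) (f : HardySpace n) : inner ℂ (kernel z) f = f z.1 := by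
  rw [HardySpace.inner_eq]
  refine (lp.hasSum_inner _ _).unique
    ((hasSum_taylor f.memHardy.differentiableOn z.2).congr_fun fun k => ?_)
  rw [HardySpace.toL2_apply, HardySpace.toL2_apply, taylor_kernel, RCLike.inner_apply,
    RingHomCompTriple.comp_apply]
  simp

theorem norm_sq_kernel (z : polydisc n) : ‖kernel z‖ ^ 2 = ∏ i, 1 / (1 - ‖z.1 i‖ ^ 2) := by
  have h := inner_kernel z (kernel z)
  rw [inner_self_eq_norm_sq_to_K, kernel_apply] at h
  have : ∀ i, conj (z.1 i) * z.1 i = ((‖z.1 i‖ ^ 2 : ℝ) : ℂ) := fun i => by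
    rw [Complex.conj_mul']; push_cast; rfl
  simp_rw [this] at h
  refine Complex.ofReal_injective ?_
  push_cast at h ⊢
  exact h

/-- By the reproducing property, `‖k_w - k_z‖²` equals `k_w(w) - 2 Re k_w(z) + k_z(z)`, which is
explicit, continuous in `w` and zero at `w = z`. This yields norm continuity of `t ↦ k_{φᵗ(x₀)}`. -/
theorem continuous_kernel : Continuous (kernel (n := n)) := by
  rw [continuous_iff_continuousAt]
  intro z
  rw [ContinuousAt, tendsto_iff_norm_sub_tendsto_zero]
  have hne : ∀ (x y : polydisc n) i, 1 - conj (x.1 i) * y.1 i ≠ 0 := by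
    intro x y i h
    have h1 : ‖conj (x.1 i) * y.1 i‖ < 1 := by
      rw [norm_mul, RCLike.norm_conj]
      exact mul_lt_one_of_nonneg_of_lt_one_left (norm_nonneg _) (x.2 i) (y.2 i).le
    rw [← sub_eq_zero.mp h, norm_one] at h1
    exact lt_irrefl _ h1
  have hsq : Tendsto (fun w => ‖kernel w - kernel z‖ ^ 2) (𝓝 z) (𝓝 0) := by
    have e : ∀ w : polydisc n, ‖kernel w - kernel z‖ ^ 2 =
        Complex.re (kernel w w.1) - 2 * Complex.re (kernel w z.1)
          + Complex.re (kernel z z.1) := by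
      intro w
      rw [@norm_sub_sq ℂ, ← inner_kernel w (kernel w), ← inner_kernel z (kernel z),
        inner_self_eq_norm_sq_to_K, inner_self_eq_norm_sq_to_K, inner_kernel w,
        ← inner_kernel z, ← inner_conj_symm, inner_kernel]
      simp [← Complex.ofReal_pow]
    simp_rw [e, kernel_apply]
    have hc : Continuous fun w : polydisc n =>
        Complex.re (∏ i, 1 / (1 - conj (w.1 i) * w.1 i))
          - 2 * Complex.re (∏ i, 1 / (1 - conj (w.1 i) * z.1 i))
          + Complex.re (∏ i, 1 / (1 - conj (z.1 i) * z.1 i)) := by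
      have hi : ∀ i, Continuous fun w : polydisc n => w.1 i := fun i =>
        (continuous_apply i).comp continuous_subtype_val
      have hi' : ∀ i, Continuous fun w : polydisc n => conj (w.1 i) := fun i =>
        Complex.continuous_conj.comp (hi i)
      refine ((Complex.continuous_re.comp ?_).sub
        (continuous_const.mul (Complex.continuous_re.comp ?_))).add continuous_const
      · exact continuous_finsetProd _ fun i _ => continuous_const.div
          (continuous_const.sub ((hi' i).mul (hi i))) fun w => hne w w i
      · exact continuous_finsetProd _ fun i _ => continuous_const.div
          (continuous_const.sub ((hi' i).mul continuous_const)) fun w => hne w z i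
    refine (hc.tendsto z).trans_eq ?_
    congr 1
    ring
  have := hsq.sqrt
  simpa using this

/-- Cauchy–Schwarz against `k_z`, whose norm grows with each `|zᵢ|` and is therefore uniformly
bounded for `‖z‖ ≤ r`. -/
theorem exists_norm_apply_le {r : ℝ} (hr0 : 0 ≤ r) (hr : r < 1) :
    ∃ C : ℝ, 0 ≤ C ∧ ∀ (f : HardySpace n) (z : Fin n → ℂ), ‖z‖ ≤ r → ‖f z‖ ≤ C * ‖f‖ := by
  refine ⟨√(∏ _i : Fin n, 1 / (1 - r ^ 2)), Real.sqrt_nonneg _, fun f z hz => ?_⟩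
  have hz' : z ∈ polydisc n := mem_polydisc_iff_norm.mpr (hz.trans_lt hr)
  have h := norm_inner_le_norm (𝕜 := ℂ) (kernel ⟨z, hz'⟩) f
  rw [inner_kernel] at h
  refine h.trans (mul_le_mul_of_nonneg_right (Real.le_sqrt_of_sq_le ?_) (norm_nonneg _))
  rw [norm_sq_kernel]
  have hr2 : 0 < 1 - r ^ 2 := by nlinarith
  have hi : ∀ i, ‖z i‖ ^ 2 ≤ r ^ 2 := fun i =>
    pow_le_pow_left₀ (norm_nonneg _) ((norm_le_pi_norm z i).trans hz) 2
  refine Finset.prod_le_prod (fun i _ => ?_) fun i _ => ?_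
  · have := hi i
    exact one_div_nonneg.mpr (by linarith)
  · exact one_div_le_one_div_of_le hr2 (by linarith [hi i])

/-! ### Totality of the kernels and weak convergence -/

theorem eq_zero_of_inner_kernel {u : HardySpace n} (hu : ∀ z, inner ℂ (kernel z) u = 0) :
    u = 0 := by
  refine DFunLike.ext _ _ fun z => ?_
  by_cases hz : z ∈ polydisc n
  · rw [← inner_kernel ⟨z, hz⟩, hu]; rfl
  · rw [u.memHardy.eq_zero z hz]; rfl

/-- Bounded and pointwise convergence give weak convergence, here against a strongly convergent
family. -/
theorem tendsto_inner_of_bounded_of_tendsto_apply {ι : Type*} {l : Filter ι}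
    {v : ι → HardySpace n} {v₀ : HardySpace n} {u : ι → HardySpace n} {u₀ : HardySpace n} {C : ℝ}
    (hC : ∀ᶠ i in l, ‖v i‖ ≤ C) (hv : ∀ z ∈ polydisc n, Tendsto (fun i => v i z) l (𝓝 (v₀ z)))
    (hu : Tendsto u l (𝓝 u₀)) :
    Tendsto (fun i => inner ℂ (v i) (u i)) l (𝓝 (inner ℂ v₀ u₀)) := by
  have hspan : Dense (Submodule.span ℂ (range (kernel (n := n))) : Set (HardySpace n)) := by
    rw [Submodule.dense_iff_topologicalClosure_eq_top, Submodule.topologicalClosure_eq_top_iff,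
      Submodule.eq_bot_iff]
    intro u hu
    exact eq_zero_of_inner_kernel fun z => hu _ (Submodule.subset_span ⟨z, rfl⟩)
  have hweak : ∀ w ∈ Submodule.span ℂ (range (kernel (n := n))),
      Tendsto (fun i => inner ℂ (v i) w) l (𝓝 (inner ℂ v₀ w)) := by
    intro w hw
    induction hw using Submodule.span_induction with
    | mem w hw =>
      obtain ⟨z, rfl⟩ := hw
      have h : ∀ f : HardySpace n, inner ℂ f (kernel z) = conj (f z.1) := fun f => by
        rw [← inner_kernel, inner_conj_symm]
      simp_rw [h]
      exact (Complex.continuous_conj.tendsto _).comp (hv z z.2)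
    | zero => simp [tendsto_const_nhds]
    | add x y _ _ hx hy => simpa only [inner_add_right] using hx.add hy
    | smul c x _ hx => simpa only [inner_smul_right] using hx.const_mul c
  rw [Metric.tendsto_nhds]
  intro ε hε
  -- The summands bound the terms of the splitting `e` below. The absolute value is needed because
  -- `C` may be negative when `l` is the trivial filter.
  obtain ⟨δ, hδ, hδε⟩ : ∃ δ > 0, (|C| + ‖v₀‖) * δ + |C| * δ + δ < ε := by
    refine ⟨ε / (2 * (2 * |C| + ‖v₀‖ + 1)), by positivity, ?_⟩
    have hp : 0 < 2 * |C| + ‖v₀‖ + 1 := by positivity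
    calc _ = ε / 2 := by field_simp; ring
      _ < ε := half_lt_self hε
  obtain ⟨w, hw, hwu⟩ := Metric.dense_iff.mp hspan u₀ δ hδ
  rw [mem_ball_iff_norm] at hw
  filter_upwards [hC, Metric.tendsto_nhds.mp (hweak w hwu) δ hδ,
    Metric.tendsto_nhds.mp hu δ hδ] with i h1 h2 h3
  rw [dist_eq_norm] at h2 h3 ⊢
  have e : inner ℂ (v i) (u i) - inner ℂ v₀ u₀ = inner ℂ (v i) (u i - u₀)
      + inner ℂ (v i - v₀) (u₀ - w) + (inner ℂ (v i) w - inner ℂ v₀ w) := by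
    simp only [inner_sub_left, inner_sub_right]; ring
  have h1' : ‖v i‖ ≤ |C| := h1.trans (le_abs_self C)
  have n1 : ‖inner ℂ (v i) (u i - u₀)‖ ≤ |C| * δ :=
    (norm_inner_le_norm _ _).trans (mul_le_mul h1' h3.le (norm_nonneg _) (abs_nonneg _))
  have n2 : ‖inner ℂ (v i - v₀) (u₀ - w)‖ ≤ (|C| + ‖v₀‖) * δ := by
    refine (norm_inner_le_norm _ _).trans (mul_le_mul ((norm_sub_le _ _).trans ?_) ?_
      (norm_nonneg _) (by positivity))
    · linarith
    · rw [norm_sub_rev]; exact hw.le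
  rw [e]
  refine (norm_add₃_le).trans_lt ?_
  linarith

/-! ### Monomials -/

theorem memHardy_monomial (k : Fin n → ℕ) : MemHardy ((polydisc n).indicator (monomial k)) := by
  refine memHardy_of_bounded (C := 1) ?_ (fun z hz => indicator_of_notMem hz _) fun z hz => ?_
  · exact (HardySpace.differentiable_monomial k).differentiableOn.congr fun z hz =>
      indicator_of_mem hz _
  · rw [indicator_of_mem hz]; exact norm_monomial_le_one k hz

/-- The function `z ↦ z^k`, as an element of `H²(𝔻ⁿ)`. -/
noncomputable def hardyMonomial (k : Fin n → ℕ) : HardySpace n :=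
  ⟨(polydisc n).indicator (monomial k), memHardy_monomial k⟩

theorem hardyMonomial_apply (k : Fin n → ℕ) {z : Fin n → ℂ} (hz : z ∈ polydisc n) :
    hardyMonomial k z = monomial k z := indicator_of_mem hz _

/-- Under the isometry with `ℓ²(ℕⁿ)`, `z^k` is the `k`-th unit vector. -/
theorem inner_hardyMonomial (k : Fin n → ℕ) (f : HardySpace n) :
    inner ℂ (hardyMonomial k) f = taylor f k := by
  classical
  have h : HardySpace.toL2 (hardyMonomial k) = lp.single 2 k (1 : ℂ) := by
    ext m
    rw [HardySpace.toL2_apply]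
    rw [HardySpace.taylor_series (a := lp.single (E := fun _ : Fin n → ℕ => ℂ) 2 k (1 : ℂ))
      (C := 1) (fun m => ?_) (fun z hz => ?_) m]
    · rw [lp.coeFn_single]
      by_cases h : m = k
      · subst h; simp
      · simp [h]
    · rw [hardyMonomial_apply k hz, tsum_eq_single k]
      · simp
      · intro m hm
        simp [hm]
  rw [HardySpace.inner_eq, h, lp.inner_single_left, HardySpace.toL2_apply]
  simp

theorem eq_zero_of_inner_hardyMonomial {u : HardySpace n}
    (hu : ∀ k, inner ℂ (hardyMonomial k) u = 0) : u = 0 := by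
  refine HardySpace.toL2_injective ?_
  ext k
  rw [HardySpace.toL2_apply, ← inner_hardyMonomial, hu, map_zero]
  rfl

/-! ### Directional derivatives as bounded functionals -/

theorem HardySpace.differentiableAt (f : HardySpace n) {z : Fin n → ℂ} (hz : z ∈ polydisc n) :
    DifferentiableAt ℂ f z :=
  f.memHardy.differentiableOn.differentiableAt ((isOpen_polydisc n).mem_nhds hz)

/-- A Cauchy estimate on the ball of radius `r - ‖z‖` about `z`. This ball stays where `|f| ≤ C‖f‖`,
so `f` differs there from its central value by at most `2C‖f‖`. -/
theorem exists_norm_fderiv_le (z : polydisc n) :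
    ∃ C : ℝ, ∀ f : HardySpace n, ‖fderiv ℂ f z.1‖ ≤ C * ‖f‖ := by
  have hz := mem_polydisc_iff_norm.mp z.2
  obtain ⟨r, hzr, hr1⟩ := exists_between hz
  obtain ⟨C, hC0, hC⟩ := exists_norm_apply_le (n := n) ((norm_nonneg _).trans hzr.le) hr1
  have hpos : 0 < r - ‖z.1‖ := sub_pos.mpr hzr
  refine ⟨2 * C / (r - ‖z.1‖), fun f => ?_⟩
  have hball : ∀ y ∈ Metric.ball z.1 (r - ‖z.1‖), ‖y‖ ≤ r := by
    intro y hy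
    rw [mem_ball_iff_norm] at hy
    have h1 : ‖y‖ ≤ ‖y - z.1‖ + ‖z.1‖ := by simpa using norm_add_le (y - z.1) z.1
    linarith
  refine (Complex.norm_fderiv_le_div_of_mapsTo_ball (R₁ := r - ‖z.1‖) (R₂ := 2 * C * ‖f‖)
    (f.memHardy.differentiableOn.mono fun y hy =>
      mem_polydisc_iff_norm.mpr ((hball y hy).trans_lt hr1)) (fun y hy => ?_) hpos).trans_eq
    (by ring)
  rw [mem_closedBall_iff_norm]
  refine (norm_sub_le _ _).trans ?_
  linarith [hC f y (hball y hy), hC f z.1 hzr.le]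

/-- The bounded functional `f ↦ Df(z) v` on `H²(𝔻ⁿ)`. -/
noncomputable def fderivFunctional (z : polydisc n) (v : Fin n → ℂ) : HardySpace n →L[ℂ] ℂ :=
  LinearMap.mkContinuousOfExistsBound
    { toFun := fun f => fderiv ℂ f z.1 v
      map_add' := fun f g => by
        have e : fderiv ℂ ⇑(f + g) z.1 = fderiv ℂ ⇑f z.1 + fderiv ℂ ⇑g z.1 :=
          fderiv_add (f.differentiableAt z.2) (g.differentiableAt z.2)
        rw [e]; rfl
      map_smul' := fun c f => by
        have e : fderiv ℂ ⇑(c • f) z.1 = c • fderiv ℂ ⇑f z.1 :=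
          fderiv_const_smul (f.differentiableAt z.2) c
        rw [e]; rfl } <| by
    obtain ⟨C, hC⟩ := exists_norm_fderiv_le z
    exact ⟨C * ‖v‖, fun f => ((fderiv ℂ f z.1).le_opNorm v).trans
      ((mul_le_mul_of_nonneg_right (hC f) (norm_nonneg v)).trans_eq (by ring))⟩

theorem fderivFunctional_apply (z : polydisc n) (v : Fin n → ℂ) (f : HardySpace n) :
    fderivFunctional z v f = fderiv ℂ f z.1 v := rfl

theorem continuous_apply_hardySpace (z : polydisc n) :
    Continuous fun f : HardySpace n => f z.1 := by
  simp_rw [← inner_kernel]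
  fun_prop

/-! ### The generator -/

theorem fieldDeriv_apply (F : (Fin n → ℂ) → Fin n → ℂ) (f : (Fin n → ℂ) → ℂ) {z : Fin n → ℂ}
    (hz : z ∈ polydisc n) : fieldDeriv F f z = fderiv ℂ f z (F z) := by
  rw [fieldDeriv, indicator_of_mem hz]
  conv_rhs => rw [pi_eq_sum_univ' (F z), map_sum]
  refine Finset.sum_congr rfl fun k _ => ?_
  rw [map_smul, smul_eq_mul]

theorem koopmanGenerator_apply {F : (Fin n → ℂ) → Fin n → ℂ} (f : (koopmanGenerator F).domain)
    {z : Fin n → ℂ} (hz : z ∈ polydisc n) :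
    koopmanGenerator F f z = fderiv ℂ (f : HardySpace n) z (F z) :=
  fieldDeriv_apply F _ hz

/-- Two elements of `H²(𝔻ⁿ)` related by `g = F · ∇f` on the polydisc are in the graph. -/
theorem mem_graph_koopmanGenerator_iff {F : (Fin n → ℂ) → Fin n → ℂ}
    {p : HardySpace n × HardySpace n} :
    p ∈ (koopmanGenerator F).graph ↔
      ∀ z ∈ polydisc n, p.2 z = fderiv ℂ p.1 z (F z) := by
  rw [LinearPMap.mem_graph_iff]
  constructor
  · rintro ⟨f, h1, h2⟩ z hz
    rw [← h1, ← h2, koopmanGenerator_apply f hz]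
  · intro h
    have e : fieldDeriv F p.1 = p.2 := by
      ext z
      by_cases hz : z ∈ polydisc n
      · rw [fieldDeriv_apply F _ hz, h z hz]
      · rw [p.2.memHardy.eq_zero z hz, fieldDeriv, indicator_of_notMem hz]
    have hm : MemHardy (fieldDeriv F p.1) := by rw [e]; exact p.2.memHardy
    exact ⟨⟨p.1, hm⟩, rfl, DFunLike.coe_injective e⟩

/-- The graph is cut out by one equation per point of `𝔻ⁿ`, and both sides of each equation are
continuous in the pair. -/
theorem isClosed_koopmanGenerator (F : (Fin n → ℂ) → Fin n → ℂ) :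
    (koopmanGenerator F).IsClosed := by
  have h : ((koopmanGenerator F).graph : Set (HardySpace n × HardySpace n)) =
      ⋂ z : polydisc n, {p | p.2 z.1 = fderivFunctional z (F z.1) p.1} := by
    ext p
    simp only [SetLike.mem_coe, mem_graph_koopmanGenerator_iff, mem_iInter, Subtype.forall,
      mem_ofPred_eq, fderivFunctional_apply]
  rw [LinearPMap.IsClosed, h]
  exact isClosed_iInter fun z => isClosed_eq
    ((continuous_apply_hardySpace z).comp continuous_snd)
    ((fderivFunctional z (F z.1)).continuous.comp continuous_fst)

theorem exists_norm_fderiv_monomial_le (k : Fin n → ℕ) :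
    ∃ L : ℝ, 0 ≤ L ∧ ∀ z ∈ polydisc n, ‖fderiv ℂ (monomial k) z‖ ≤ L := by
  have hc : ContDiff ℂ 1 (monomial k) := by unfold monomial; fun_prop
  obtain ⟨L, hL⟩ := (isCompact_closedBall (0 : Fin n → ℂ) 1).exists_bound_of_continuousOn
    (hc.continuous_fderiv one_ne_zero).continuousOn
  exact ⟨max L 0, le_max_right _ _, fun z hz => (hL z (mem_closedBall_zero_iff.mpr
    (mem_polydisc_iff_norm.mp hz).le)).trans (le_max_left _ _)⟩

theorem fderiv_hardyMonomial (k : Fin n → ℕ) {z : Fin n → ℂ} (hz : z ∈ polydisc n) :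
    fderiv ℂ (hardyMonomial k) z = fderiv ℂ (monomial k) z := by
  refine Filter.EventuallyEq.fderiv_eq ?_
  filter_upwards [(isOpen_polydisc n).mem_nhds hz] with w hw
  exact hardyMonomial_apply k hw

theorem exists_lipschitz_hardyMonomial (k : Fin n → ℕ) :
    ∃ L : ℝ, 0 ≤ L ∧ ∀ z ∈ polydisc n, ∀ w ∈ polydisc n,
      ‖hardyMonomial k z - hardyMonomial k w‖ ≤ L * ‖z - w‖ := by
  obtain ⟨L, hL0, hL⟩ := exists_norm_fderiv_monomial_le k
  refine ⟨L, hL0, fun z hz w hw => ?_⟩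
  refine Convex.norm_image_sub_le_of_norm_fderiv_le (𝕜 := ℂ) (s := polydisc n)
    (fun y hy => (hardyMonomial k).differentiableAt hy) (fun y hy => ?_) ?_ hw hz
  · rw [fderiv_hardyMonomial k hy]; exact hL y hy
  · rw [polydisc_eq_ball]; exact convex_ball _ _

namespace IsHolomorphicFlow

variable {F : (Fin n → ℂ) → Fin n → ℂ} {φ : ℝ → (Fin n → ℂ) → Fin n → ℂ}

theorem exists_norm_field_le (h : IsHolomorphicFlow F φ) :
    ∃ M, 0 ≤ M ∧ ∀ z ∈ polydisc n, ‖F z‖ ≤ M :=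
  exists_norm_le_of_continuousOn h.differentiableOn_field h.continuousOn_field

/-- Both `F` and the derivative of `z^k` are bounded on `𝔻ⁿ`, so `F · ∇z^k` is a bounded holomorphic
function. -/
theorem hardyMonomial_mem_domain (h : IsHolomorphicFlow F φ) (k : Fin n → ℕ) :
    hardyMonomial k ∈ (koopmanGenerator F).domain := by
  obtain ⟨M, hM0, hM⟩ := h.exists_norm_field_le
  obtain ⟨L, hL0, hL⟩ := exists_norm_fderiv_monomial_le k
  have hc : ContDiff ℂ 2 (monomial k) := by unfold monomial; fun_prop
  have hd : Differentiable ℂ (fderiv ℂ (monomial k)) :=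
    (hc.fderiv_right (m := 1) (by norm_num)).differentiable one_ne_zero
  have e : ∀ z ∈ polydisc n, fieldDeriv F (hardyMonomial k) z = fderiv ℂ (monomial k) z (F z) :=
    fun z hz => by rw [fieldDeriv_apply F _ hz, fderiv_hardyMonomial k hz]
  refine memHardy_of_bounded (C := L * M) ?_ (fun z hz => indicator_of_notMem hz _) fun z hz => ?_
  · exact (hd.differentiableOn.clm_apply h.differentiableOn_field).congr e
  · rw [e z hz]
    exact ((fderiv ℂ (monomial k) z).le_opNorm _).trans
      (mul_le_mul (hL z hz) (hM z hz) (norm_nonneg _) hL0)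

theorem dense_domain (h : IsHolomorphicFlow F φ) :
    Dense ((koopmanGenerator F).domain : Set (HardySpace n)) := by
  rw [Submodule.dense_iff_topologicalClosure_eq_top, Submodule.topologicalClosure_eq_top_iff,
    Submodule.eq_bot_iff]
  exact fun u hu => eq_zero_of_inner_hardyMonomial fun k => hu _ (h.hardyMonomial_mem_domain k)

end IsHolomorphicFlow

/-! ### The adjoint and the second adjoint of the generator -/

/-- The vector representing `f ↦ F(z) · ∇f(z)`. -/
noncomputable def fieldKernel (F : (Fin n → ℂ) → Fin n → ℂ) (z : polydisc n) : HardySpace n :=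
  (InnerProductSpace.toDual ℂ (HardySpace n)).symm (fderivFunctional z (F z.1))

theorem inner_fieldKernel (F : (Fin n → ℂ) → Fin n → ℂ) (z : polydisc n) (f : HardySpace n) :
    inner ℂ (fieldKernel F z) f = fderiv ℂ f z.1 (F z.1) :=
  InnerProductSpace.toDual_symm_apply

theorem inner_fieldKernel_eq (F : (Fin n → ℂ) → Fin n → ℂ) (z : polydisc n)
    (f : (koopmanGenerator F).domain) :
    inner ℂ (fieldKernel F z) (f : HardySpace n) = inner ℂ (kernel z) (koopmanGenerator F f) := by
  rw [inner_fieldKernel, inner_kernel, koopmanGenerator_apply f z.2]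

/-- On the domain, `f ↦ (A_F f)(z)` agrees with `f ↦ Df(z)F(z)`, which is bounded on the whole
space. -/
theorem kernel_mem_adjoint_domain (F : (Fin n → ℂ) → Fin n → ℂ) (z : polydisc n) :
    kernel z ∈ (koopmanGenerator F).adjoint.domain :=
  LinearPMap.mem_adjoint_domain_of_exists _ ⟨fieldKernel F z, inner_fieldKernel_eq F z⟩

theorem dense_adjoint_domain (F : (Fin n → ℂ) → Fin n → ℂ) :
    Dense ((koopmanGenerator F).adjoint.domain : Set (HardySpace n)) := by
  rw [Submodule.dense_iff_topologicalClosure_eq_top, Submodule.topologicalClosure_eq_top_iff,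
    Submodule.eq_bot_iff]
  exact fun u hu => eq_zero_of_inner_kernel fun z => hu _ (kernel_mem_adjoint_domain F z)

/-- The second adjoint of `A_F` acts as `F · ∇`. -/
theorem adjoint_adjoint_apply {F : (Fin n → ℂ) → Fin n → ℂ}
    (hF : Dense ((koopmanGenerator F).domain : Set (HardySpace n)))
    (g : (koopmanGenerator F).adjoint.adjoint.domain) {z : Fin n → ℂ} (hz : z ∈ polydisc n) :
    (koopmanGenerator F).adjoint.adjoint g z = fderiv ℂ (g : HardySpace n) z (F z) := by
  set x : (koopmanGenerator F).adjoint.domain :=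
    ⟨kernel ⟨z, hz⟩, kernel_mem_adjoint_domain F ⟨z, hz⟩⟩
  -- Moving `A_F^**` off `g` leaves `A_F^* k_z`, which is `fieldKernel F z`. After conjugation both
  -- pairings are values at `z`.
  have h1 := LinearPMap.adjoint_isFormalAdjoint (dense_adjoint_domain F) g x
  have hx : (koopmanGenerator F).adjoint x = fieldKernel F ⟨z, hz⟩ :=
    LinearPMap.adjoint_apply_eq hF x (inner_fieldKernel_eq F ⟨z, hz⟩)
  rw [hx] at h1
  have h2 := congrArg conj h1
  rwa [inner_conj_symm, inner_conj_symm, inner_kernel, inner_fieldKernel] at h2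

/-- A pseudo-weak solution for `A_F^*` is tested against the domain of `A_F^**`. This inclusion
makes elements of the domain of `A_F` admissible. -/
theorem koopmanGenerator_le_adjoint_adjoint {F : (Fin n → ℂ) → Fin n → ℂ}
    (hF : Dense ((koopmanGenerator F).domain : Set (HardySpace n))) :
    koopmanGenerator F ≤ (koopmanGenerator F).adjoint.adjoint :=
  (LinearPMap.adjoint_isFormalAdjoint hF).le_adjoint (dense_adjoint_domain F)

/-! ### Koopman operators -/

/-- On the image of `ψ` one has `|f| ≤ C‖f‖`. Hence `f ∘ ψ` is a bounded function, and the same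
estimate gives both membership in `H²` and the operator bound. -/
theorem exists_compositionOperator {ψ : (Fin n → ℂ) → Fin n → ℂ}
    (hd : DifferentiableOn ℂ ψ (polydisc n)) {R : ℝ} (hR0 : 0 ≤ R) (hR1 : R < 1)
    (hR : ∀ z ∈ polydisc n, ‖ψ z‖ ≤ R) :
    ∃ K : HardySpace n →L[ℂ] HardySpace n, IsCompositionOperator ψ K := by
  obtain ⟨C, hC0, hC⟩ := exists_norm_apply_le (n := n) hR0 hR1
  have hmaps : MapsTo ψ (polydisc n) (polydisc n) := fun z hz =>
    mem_polydisc_iff_norm.mpr ((hR z hz).trans_lt hR1)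
  have hmem : ∀ f : HardySpace n, MemHardy ((polydisc n).indicator fun z => f (ψ z)) := by
    intro f
    refine memHardy_of_bounded (C := C * ‖f‖) ?_ (fun z hz => indicator_of_notMem hz _)
      fun z hz => ?_
    · exact (f.memHardy.differentiableOn.comp hd hmaps).congr fun z hz => indicator_of_mem hz _
    · rw [indicator_of_mem hz]; exact hC f _ (hR z hz)
  let Kf : HardySpace n → HardySpace n := fun f => ⟨_, hmem f⟩
  have hval : ∀ (f : HardySpace n), ∀ z ∈ polydisc n, Kf f z = f (ψ z) :=
    fun f z hz => indicator_of_mem hz fun z => f (ψ z)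
  refine ⟨LinearMap.mkContinuous
    { toFun := Kf
      map_add' := fun f g => Subtype.ext (indicator_add _ (fun z => f (ψ z)) fun z => g (ψ z))
      map_smul' := fun c f => Subtype.ext (indicator_const_smul _ c fun z => f (ψ z)) }
    C fun f => ?_, hval⟩
  refine HardySpace.norm_le_of_bounded _ (by positivity) fun z hz => ?_
  exact (congrArg norm (hval f z hz)).trans_le (hC f _ (hR z hz))

/-- Both vectors represent the functional `f ↦ f(ψ x)`. -/
theorem adjoint_compositionOperator_kernel {ψ : (Fin n → ℂ) → Fin n → ℂ}
    {K : HardySpace n →L[ℂ] HardySpace n} (hK : IsCompositionOperator ψ K) (x : polydisc n)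
    (hx : ψ x.1 ∈ polydisc n) :
    ContinuousLinearMap.adjoint K (kernel x) = kernel ⟨ψ x.1, hx⟩ := by
  refine ext_inner_right ℂ fun f => ?_
  rw [ContinuousLinearMap.adjoint_inner_left, inner_kernel, inner_kernel, hK f x.1 x.2]

theorem inner_kernel_right (z : polydisc n) (f : HardySpace n) :
    inner ℂ f (kernel z) = conj (f z.1) := by
  rw [← inner_kernel, inner_conj_symm]

namespace IsHolomorphicFlow

variable {F : (Fin n → ℂ) → Fin n → ℂ} {φ : ℝ → (Fin n → ℂ) → Fin n → ℂ}

theorem exists_koopman (h : IsHolomorphicFlow F φ) (hinv : MapsTorusInside φ) :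
    ∃ K : ℝ → HardySpace n →L[ℂ] HardySpace n, ∀ t, 0 ≤ t → IsCompositionOperator (φ t) (K t) := by
  have hex : ∀ t : ℝ, ∃ K : HardySpace n →L[ℂ] HardySpace n,
      0 ≤ t → IsCompositionOperator (φ t) K := by
    intro t
    -- Negative times carry no condition and get the value `0`. At `t = 0` the torus is not mapped
    -- inside, but the operator is the identity. For `t > 0` the maximum principle extends the bound
    -- `R` to the polydisc.
    rcases lt_trichotomy t 0 with ht | rfl | ht
    · exact ⟨0, fun h0 => absurd h0 ht.not_ge⟩
    · refine ⟨ContinuousLinearMap.id ℂ _, fun _ f z hz => ?_⟩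
      rw [h.map_zero z hz]; rfl
    · obtain ⟨R, hR0, hR1, hR⟩ := hinv t ht
      obtain ⟨K, hK⟩ := exists_compositionOperator (h.differentiableOn_flow t ht.le) hR0.le hR1
        fun z hz => norm_le_of_norm_le_on_torus (h.differentiableOn_flow t ht.le)
          (h.continuousOn_flow t ht.le)
          (fun w hw => (pi_norm_le_iff_of_nonneg hR0.le).mpr fun j => (hR w hw j).le) hz
      exact ⟨K, fun _ => hK⟩
  choose K hK using hex
  exact ⟨K, hK⟩

/-- The derivative of `f` along the flow. -/
theorem hasDerivWithinAt_comp (h : IsHolomorphicFlow F φ) {f : (Fin n → ℂ) → ℂ}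
    (hf : DifferentiableOn ℂ f (polydisc n)) {z : Fin n → ℂ} (hz : z ∈ polydisc n) {t : ℝ}
    (ht : 0 ≤ t) :
    HasDerivWithinAt (fun s => f (φ s z)) (fderiv ℂ f (φ t z) (F (φ t z))) (Ici 0) t := by
  have h1 := (hf.differentiableAt ((isOpen_polydisc n).mem_nhds
    (h.mapsTo t ht hz))).hasFDerivAt.restrictScalars ℝ
  exact h1.comp_hasDerivWithinAt t (h.hasDeriv z hz t ht)

/-- The generator commutes with the flow. -/
theorem fderiv_comp_flow (h : IsHolomorphicFlow F φ) {f : (Fin n → ℂ) → ℂ}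
    (hf : DifferentiableOn ℂ f (polydisc n)) {z : Fin n → ℂ} (hz : z ∈ polydisc n) {t : ℝ}
    (ht : 0 ≤ t) :
    fderiv ℂ (fun w => f (φ t w)) z (F z) = fderiv ℂ f (φ t z) (F (φ t z)) := by
  -- The right derivative at `s = 0` of `f(φ^{t+s}(z))` is computed twice: for `f ∘ φᵗ` along
  -- `φˢ(z)`, and for `f` along the orbit at time `t`.
  have h1 := h.hasDerivWithinAt_comp
    (hf.comp (h.differentiableOn_flow t ht) (h.mapsTo t ht)) hz le_rfl
  have h2 : HasDerivWithinAt (fun s => f (φ (t + s) z)) (fderiv ℂ f (φ t z) (F (φ t z)))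
      (Ici 0) 0 := by
    have h3 : HasDerivWithinAt (fun s : ℝ => t + s) 1 (Ici 0) 0 :=
      ((hasDerivAt_id (0 : ℝ)).const_add t).hasDerivWithinAt
    have h4 : HasDerivWithinAt (fun s => f (φ s z)) (fderiv ℂ f (φ t z) (F (φ t z))) (Ici 0)
        (t + 0) := by simpa using h.hasDerivWithinAt_comp hf hz ht
    have h5 := h4.scomp (0 : ℝ) h3 fun s hs => add_nonneg ht hs
    rw [one_smul] at h5
    exact h5
  have h3 := h2.congr (f₁ := fun s => (f ∘ φ t) (φ s z))
    (fun s hs => by rw [Function.comp_apply, h.map_add t ht s hs z hz])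
    (by rw [Function.comp_apply, h.map_add t ht 0 le_rfl z hz])
  have h4 := (uniqueDiffWithinAt_Ici (0 : ℝ)).eq_deriv _ h1 h3
  rwa [h.map_zero z hz] at h4

theorem norm_flow_sub_le (h : IsHolomorphicFlow F φ) {M : ℝ}
    (hM : ∀ z ∈ polydisc n, ‖F z‖ ≤ M) {z : Fin n → ℂ} (hz : z ∈ polydisc n) {s t : ℝ}
    (hs : 0 ≤ s) (ht : 0 ≤ t) : ‖φ t z - φ s z‖ ≤ M * |t - s| :=
  (convex_Ici (0 : ℝ)).norm_image_sub_le_of_norm_hasDerivWithin_le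
    (fun r hr => h.hasDeriv z hz r hr) (fun r hr => hM _ (h.mapsTo r hr hz)) hs ht

variable {K : ℝ → HardySpace n →L[ℂ] HardySpace n}

/-- `A_F` commutes with `K(t)`, by `fderiv_comp_flow`. The graph form gives both that the domain is
preserved and the value of `A_F` on `K(t)g`. -/
theorem koopman_mem_graph (h : IsHolomorphicFlow F φ)
    (hK : ∀ t, 0 ≤ t → IsCompositionOperator (φ t) (K t)) (g : (koopmanGenerator F).domain)
    {t : ℝ} (ht : 0 ≤ t) :
    (K t g, K t (koopmanGenerator F g)) ∈ (koopmanGenerator F).graph := by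
  rw [mem_graph_koopmanGenerator_iff]
  intro z hz
  have e : fderiv ℂ (K t g) z = fderiv ℂ (fun w => (g : HardySpace n) (φ t w)) z := by
    refine Filter.EventuallyEq.fderiv_eq ?_
    filter_upwards [(isOpen_polydisc n).mem_nhds hz] with w hw
    exact hK t ht g w hw
  rw [hK t ht _ z hz, koopmanGenerator_apply g (h.mapsTo t ht hz), e,
    h.fderiv_comp_flow (g : HardySpace n).memHardy.differentiableOn hz ht]

/-- Orbits move with speed at most `sup ‖F‖`, and `z^k` is Lipschitz on the polydisc. The resulting
sup-norm estimate dominates the Hardy norm. -/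
theorem exists_norm_koopman_hardyMonomial_sub_le (h : IsHolomorphicFlow F φ)
    (hK : ∀ t, 0 ≤ t → IsCompositionOperator (φ t) (K t)) (k : Fin n → ℕ) :
    ∃ C : ℝ, 0 ≤ C ∧ ∀ s, 0 ≤ s → ∀ t, 0 ≤ t →
      ‖K t (hardyMonomial k) - K s (hardyMonomial k)‖ ≤ C * |t - s| := by
  obtain ⟨M, hM0, hM⟩ := h.exists_norm_field_le
  obtain ⟨L, hL0, hL⟩ := exists_lipschitz_hardyMonomial k
  refine ⟨L * M, by positivity, fun s hs t ht =>
    HardySpace.norm_le_of_bounded _ (by positivity) fun z hz => ?_⟩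
  have e : (K t (hardyMonomial k) - K s (hardyMonomial k)) z =
      hardyMonomial k (φ t z) - hardyMonomial k (φ s z) := by
    rw [← hK t ht _ z hz, ← hK s hs _ z hz]; rfl
  rw [e, mul_assoc]
  exact (hL _ (h.mapsTo t ht hz) _ (h.mapsTo s hs hz)).trans
    (mul_le_mul_of_nonneg_left (h.norm_flow_sub_le hM hz hs ht) hL0)

/-! ### Existence: the kernel transported by the flow -/

theorem isPseudoWeakSolution_kernel (h : IsHolomorphicFlow F φ) (x : polydisc n)
    {f : ℝ → HardySpace n}
    (hf : ∀ (t : ℝ) (ht : 0 ≤ t), f t = kernel ⟨φ t x.1, h.mapsTo t ht x.2⟩) :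
    IsPseudoWeakSolution (koopmanGenerator F).adjoint (fun _ => 0) (kernel x) f := by
  have hcont : ∀ τ, 0 < τ → ContinuousOn f (Icc 0 τ) := by
    intro τ _
    have hφ : ContinuousOn (fun t => φ t x.1) (Icc 0 τ) := fun t ht =>
      (h.hasDeriv x.1 x.2 t ht.1).continuousWithinAt.mono Icc_subset_Ici_self
    rw [continuousOn_iff_continuous_domRestrict] at hφ ⊢
    exact (continuous_kernel.comp (hφ.subtype_mk fun t => h.mapsTo t.1 t.2.1 x.2)).congr
      fun t => (hf t.1 t.2.1).symm
  have hderiv : ∀ g : (koopmanGenerator F).adjoint.adjoint.domain, ∀ t, 0 ≤ t →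
      HasDerivWithinAt (fun s => inner ℂ (g : HardySpace n) (f s))
        (inner ℂ ((koopmanGenerator F).adjoint.adjoint g) (f t)) (Ici 0) t := by
    intro g t ht
    -- Conjugation is real-linear, so it commutes with the derivative in real time.
    have h1 := Complex.conjCLE.hasFDerivAt.comp_hasDerivWithinAt t
      (h.hasDerivWithinAt_comp (g : HardySpace n).memHardy.differentiableOn x.2 ht)
    have e : ∀ s, 0 ≤ s → inner ℂ (g : HardySpace n) (f s) =
        conj ((g : HardySpace n) (φ s x.1)) := fun s hs => by
      rw [hf s hs, inner_kernel_right]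
    rw [hf t ht, inner_kernel_right, adjoint_adjoint_apply h.dense_domain g (h.mapsTo t ht x.2)]
    exact h1.congr (fun s hs => e s hs) (e t ht)
  refine ⟨?_, hcont, fun g τ hτ => ?_, fun g t ht => ?_⟩
  · rw [hf 0 le_rfl]
    congr
    exact h.map_zero x.1 x.2
  · obtain ⟨C, hC⟩ := isCompact_Icc.exists_bound_of_continuousOn (hcont τ hτ)
    -- Absolute continuity follows from a Lipschitz bound: the derivative is at most `‖A_F^** g‖`
    -- times the supremum of `‖f‖` on `[0, τ]`.
    have hl : LipschitzOnWith (‖(koopmanGenerator F).adjoint.adjoint g‖₊ * C.toNNReal)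
        (fun s => inner ℂ (g : HardySpace n) (f s)) (Icc 0 τ) := by
      refine (convex_Icc 0 τ).lipschitzOnWith_of_nnnorm_hasDerivWithin_le
        (fun t ht => (hderiv g t ht.1).mono Icc_subset_Ici_self) fun t ht => ?_
      refine (nnnorm_inner_le_nnnorm _ _).trans (mul_le_mul_right ?_ _)
      exact NNReal.coe_le_coe.mp ((hC t ht).trans (Real.le_coe_toNNReal C))
    rw [← uIcc_of_le hτ.le] at hl
    exact hl.absolutelyContinuousOnInterval
  · simpa using hderiv g t ht

/-! ### Uniqueness: the duality identity -/

/-- The pairing of `K(T - s)z^k` with `f(s)` is constant on `[0, T]`, and its values at `s = T` and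
`s = 0` are the two sides. -/
theorem inner_koopman_eq_of_isPseudoWeakSolution (h : IsHolomorphicFlow F φ)
    (hK : ∀ t, 0 ≤ t → IsCompositionOperator (φ t) (K t)) {f₀ : HardySpace n}
    {f : ℝ → HardySpace n}
    (hf : IsPseudoWeakSolution (koopmanGenerator F).adjoint (fun _ => 0) f₀ f)
    (k : Fin n → ℕ) {T : ℝ} (hT : 0 ≤ T) :
    inner ℂ (K 0 (hardyMonomial k)) (f T) = inner ℂ (K T (hardyMonomial k)) f₀ := by
  set g : HardySpace n := hardyMonomial k
  obtain ⟨C, hC0, hC⟩ := h.exists_norm_koopman_hardyMonomial_sub_le hK k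
  -- The end point `T + 1` keeps the interval nondegenerate when `T = 0`.
  have hfc : ContinuousOn f (Icc 0 (T + 1)) := hf.continuousOn _ (by linarith)
  have hKc : ContinuousOn (fun s => K (T - s) g) (Icc 0 T) := by
    refine LipschitzOnWith.continuousOn (K := ⟨C, hC0⟩)
      (LipschitzOnWith.of_dist_le_mul fun s hs t ht => ?_)
    rw [dist_eq_norm, dist_comm, Real.dist_eq]
    refine (hC _ (sub_nonneg.mpr ht.2) _ (sub_nonneg.mpr hs.2)).trans_eq ?_
    rw [sub_sub_sub_cancel_left]; rfl
  have hcont : ContinuousOn (fun s => inner ℂ (K (T - s) g) (f s)) (Icc 0 T) :=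
    ContinuousOn.inner (𝕜 := ℂ) hKc (hfc.mono (Icc_subset_Icc_right (by linarith)))
  have hconst := constant_of_has_deriv_right_zero hcont fun s hs => ?_
  · have := hconst T (right_mem_Icc.mpr hT)
    simpa [hf.initial] using this
  have hTs : 0 < T - s := sub_pos.mpr hs.2
  -- `g'` is `K(T - s)g` as an element of the domain of `A_F`. Frozen at time `s`, it is an
  -- admissible test vector, and the derivative of its pairing with `f` is the pairing of `w` with
  -- `f s`.
  obtain ⟨g', hg', hAg'⟩ := (LinearPMap.mem_graph_iff _).mp
    (h.koopman_mem_graph hK ⟨g, h.hardyMonomial_mem_domain k⟩ hTs.le)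
  set w : HardySpace n := K (T - s) (koopmanGenerator F ⟨g, h.hardyMonomial_mem_domain k⟩) with hw
  have hle := koopmanGenerator_le_adjoint_adjoint h.dense_domain
  have hd := (hf.hasDeriv ⟨g', hle.1 g'.2⟩ s hs.1).mono
    (show Ioi s ⊆ Ici 0 from fun r hr => hs.1.trans (le_of_lt hr))
  rw [← hle.2 (x := g') rfl, hAg', inner_zero_right, add_zero] at hd
  simp only [hg'] at hd
  rw [hasDerivWithinAt_iff_tendsto_slope' self_notMem_Ioi] at hd
  rw [← hasDerivWithinAt_Ioi_iff_Ici, hasDerivWithinAt_iff_tendsto_slope' self_notMem_Ioi]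
  have hIoo : Ioo s T ∈ 𝓝[>] s := Ioo_mem_nhdsGT hs.2
  -- The quotients of `r ↦ K(T - r)g` are bounded by `C` and converge pointwise to `-w`, the sign
  -- coming from the reversed time. This suffices because `f r` converges to `f s` in norm.
  have hweak : Tendsto (fun r : ℝ => inner ℂ
      (((r - s)⁻¹ : ℂ) • (K (T - r) g - K (T - s) g)) (f r)) (𝓝[>] s) (𝓝 (inner ℂ (-w) (f s))) := by
    refine tendsto_inner_of_bounded_of_tendsto_apply (C := C) ?_ (fun z hz => ?_) ?_
    · filter_upwards [hIoo] with r hr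
      have hrs : 0 < r - s := sub_pos.mpr hr.1
      rw [norm_smul, norm_inv, ← Complex.ofReal_sub, Complex.norm_real, Real.norm_eq_abs,
        inv_mul_le_iff₀ (abs_pos.mpr hrs.ne'), mul_comm]
      refine (hC _ hTs.le _ (sub_nonneg.mpr hr.2.le)).trans_eq ?_
      rw [sub_sub_sub_cancel_left, abs_sub_comm]
    · have h1 : HasDerivAt (fun r => g (φ r z)) (w z) (T - s) := by
        rw [hw, hK _ hTs.le _ z hz, koopmanGenerator_apply _ (h.mapsTo _ hTs.le hz)]
        exact (h.hasDerivWithinAt_comp g.memHardy.differentiableOn hz hTs.le).hasDerivAt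
          (Ici_mem_nhds hTs)
      have h2 : HasDerivAt (fun r : ℝ => T - r) (-1) s := (hasDerivAt_id s).const_sub T
      have h3 := (h1.scomp s h2).hasDerivWithinAt (s := Ioi s)
      rw [hasDerivWithinAt_iff_tendsto_slope' self_notMem_Ioi] at h3
      have e : (-w) z = (-1 : ℝ) • w z := by rw [neg_one_smul]; rfl
      rw [e]
      refine h3.congr' ?_
      filter_upwards [hIoo] with r hr
      have e2 : (((r - s)⁻¹ : ℂ) • (K (T - r) g - K (T - s) g)) z =
          ((r - s)⁻¹ : ℂ) * (K (T - r) g z - K (T - s) g z) := rfl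
      rw [e2, hK _ (sub_nonneg.mpr hr.2.le) _ z hz, hK _ hTs.le _ z hz, slope_def_module]
      simp
    · exact (hfc s ⟨hs.1, by linarith [hs.2]⟩).mono_of_mem_nhdsWithin
        (mem_of_superset hIoo fun r hr => ⟨hs.1.trans hr.1.le, by linarith [hr.2]⟩)
  -- Product rule at the level of slopes: the slope of the pairing is the moving quotient paired
  -- with `f r` plus the slope of `f` against the frozen `K(T - s)g`. The two limits cancel.
  have hsum := hweak.add hd
  rw [inner_neg_left, neg_add_cancel] at hsum
  refine hsum.congr' ?_
  filter_upwards with r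
  simp only [slope_def_module, inner_smul_left, inner_sub_left, Complex.real_smul]
  simp
  ring

end IsHolomorphicFlow

end PolydiscKoopman

theorem proposition3p6 (n : ℕ) (F : (Fin n → ℂ) → Fin n → ℂ) (φ : ℝ → (Fin n → ℂ) → Fin n → ℂ)
    (hflow : IsHolomorphicFlow F φ) (hinv : MapsTorusInside φ) (x₀ : polydisc n) :
    -- the operators `A_F` and `A_F^*` are densely defined and closed
    (Dense ((koopmanGenerator F).domain : Set (HardySpace n)) ∧ (koopmanGenerator F).IsClosed) ∧
    (Dense ((koopmanGenerator F).adjoint.domain : Set (HardySpace n)) ∧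
      (koopmanGenerator F).adjoint.IsClosed) ∧
    -- the Koopman operators `K(t)`, `t ≥ 0`, are bounded on the Hardy space
    ∃ K : ℝ → HardySpace n →L[ℂ] HardySpace n,
      (∀ t, 0 ≤ t → IsCompositionOperator (φ t) (K t)) ∧
      -- existence
      IsPseudoWeakSolution (koopmanGenerator F).adjoint (fun _ => 0) (kernel x₀)
        (fun t => ContinuousLinearMap.adjoint (K t) (kernel x₀)) ∧
      (∀ (t : ℝ) (ht : 0 ≤ t), ContinuousLinearMap.adjoint (K t) (kernel x₀) =
        kernel ⟨φ t x₀, hflow.mapsTo t ht x₀.2⟩) ∧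
      -- uniqueness
      ∀ f : ℝ → HardySpace n,
        IsPseudoWeakSolution (koopmanGenerator F).adjoint (fun _ => 0) (kernel x₀) f →
        ∀ t, 0 ≤ t → f t = ContinuousLinearMap.adjoint (K t) (kernel x₀) := by
  obtain ⟨K, hK⟩ := hflow.exists_koopman hinv
  have hdual : ∀ (t : ℝ) (ht : 0 ≤ t), ContinuousLinearMap.adjoint (K t) (kernel x₀) =
      kernel ⟨φ t x₀, hflow.mapsTo t ht x₀.2⟩ := fun t ht =>
    adjoint_compositionOperator_kernel (hK t ht) x₀ _
  refine ⟨⟨hflow.dense_domain, isClosed_koopmanGenerator F⟩,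
    ⟨dense_adjoint_domain F, LinearPMap.adjoint_isClosed hflow.dense_domain⟩, K, hK,
    hflow.isPseudoWeakSolution_kernel x₀ hdual, hdual, fun f hf t ht => ?_⟩
  -- Monomials are total, so it is enough to compare the pairings with each `z^k`, which the duality
  -- identity gives once `K 0` is known to fix `z^k`.
  refine sub_eq_zero.mp (eq_zero_of_inner_hardyMonomial fun k => ?_)
  have hK0 : K 0 (hardyMonomial k) = hardyMonomial k := by
    refine DFunLike.ext _ _ fun z => ?_
    by_cases hz : z ∈ polydisc n
    · rw [hK 0 le_rfl _ z hz, hflow.map_zero z hz]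
    · rw [(K 0 (hardyMonomial k)).memHardy.eq_zero z hz, (hardyMonomial k).memHardy.eq_zero z hz]
  have h := hflow.inner_koopman_eq_of_isPseudoWeakSolution hK hf k ht
  rw [hK0] at h
  rw [inner_sub_right, ContinuousLinearMap.adjoint_inner_right, h, sub_self]
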